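/- **Notation.** For $x\in\mathbb R^3$ let $S(x)$ be the skew-symmetric matrix with $S(x)y=x\times y$, let $e_3=(0,0,1)^{\mathsf T}$, and let $\|\cdot\|$ be the Euclidean norm. For a unit quaternion $Q=(\eta,q)\in\mathbb R\times\mathbb R^3$, $\eta^2+\|q\|^2=1$, put $R(Q)=I+2S(q)^2-2\eta S(q)$ and $Q^{-1}=(\eta,-q)$; the product is $(\eta_1,q_1)\odot(\eta_2,q_2)=(\eta_1\eta_2-q_1^{\mathsf T}q_2,\ \eta_1q_2+\eta_2q_1+S(q_1)q_2)$. Let $h(u)=(1+u^{\mathsf T}u)^{-1/2}u$ and $\phi(u)=\partial h/\partial u=(1+u^{\mathsf T}u)^{-3/2}(I-S(u)^2)$. For $\mu\in\mathbb R^3$ with $\|\mu\|<g$ put $u=\|\mu-ge_3\|$ and $$\eta_d(\mu)=\Big(\tfrac12\big(1+\tfrac{g-e_3^{\mathsf T}\mu}{u}\big)\Big)^{1/2},\qquad Q_d(\mu)=\Big(\eta_d,\ \tfrac{1}{2u\,\eta_d}S(\mu)e_3\Big),$$ $$M(\mu)=\tfrac{1}{4\eta_d^2u^4}\big(-4S(\mu)e_3e_3^{\mathsf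 T}+4\eta_d^2u\,S(e_3)+2S(\mu)-2(e_3^{\mathsf T}\mu)S(e_3)\big)S(\mu-ge_3)^2 .$$ **System.** Let $k_p,k_v>0$ with $k_p+k_v<g$, let $r_1,p_r\in\mathbb R^3$ be constant, and let $e_p=p-p_r$. The VTOL vehicle with position $p$, velocity $v$ and attitude $Q=(\eta,q)$, $R=R(Q)$, obeys $$\dot p=v,\qquad \dot v=ge_3-u_tR^{\mathsf T}e_3+\delta(v),\qquad \dot Q=\tfrac12\big(-q^{\mathsf T}\omega,\ (\eta I+S(q))\omega\big).$$ Write $r_2=-u_tR^{\mathsf T}e_3+\delta(v)$, $b_1=Rr_1$, $b_2=Rr_2$. For gains $\gamma_1,\gamma_2,k_1>0$ apply, with $Q_d=Q_d(\mu_d)$ and $R_d=R(Q_d)$, $$\mu_d=-k_ph(e_p)-k_vh(v),\qquad u_t=\|\mu_d-ge_3\|,$$ $$\omega=M(\mu_d)\big(f_{\mu_d}-k_v\phi(v)R_d^{\mathsf T}(b_2+u_te_3)\big)+\psi,\qquad f_{\mu_d}=-k_p\phi(e_p)v+k_v\phi(v)\big(k_ph(e_p)+k_vh(v)\big),$$ $$\psi=\gamma_1S(R_dr_1)b_1+\gamma_2k_1S\big(R_d(v-\hat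 v)\big)b_2,\qquad \dot{\hat v}=ge_3+R_d^{\mathsf T}b_2+k_1(v-\hat v)+\tfrac1{k_1}R_d^{\mathsf T}S(b_2)\psi .$$ Let $\tilde Q=(\tilde\eta,\tilde q)=Q\odot Q_d^{-1}$, $\tilde R=R(\tilde Q)$ be the attitude error and $\tilde r_2=k_1(v-\hat v)-(I-\tilde R)r_2$ the filter error. **Assumptions.** (Non-collinearity) A function $c_w(a,b)>0$ of $a,b>0$ is given, and for all $a,b>0$ the smallest eigenvalue of $-aS(r_1)^2-bS(r_2)^2$ exceeds $c_w(a,b)$ at all times along the solution. (Aerodynamic forces) Constants $c_1,c_2,c_3>0$ are given; $\delta$ is a function of $v$ only with $\delta(v)^{\mathsf T}v\le0$ and $\|\delta(v)\|\le c_1\|v\|^2$, and along the solution $\delta$ is differentiable in time with $\|\dot\delta\|<c_2+c_3\|v\|^3$. The function $c_w$ and the constants $c_i$ do not depend on $\gamma_1,\gamma_2,k_1$ or on the solution. **Theorem.** (i) Along every solution, for all $\gamma_1,\gamma_2,k_1>0$, the thrust satisfies $0<g-k_p-k_v\le u_t(t)\le g+k_p+k_v$. (ii) Fix $t_0$, initial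 values $p(t_0),v(t_0),Q(t_0)$ with $Q(t_0)$ a unit quaternion and $\tilde\eta(t_0)\ne0$, and a bound $B$ for the initial filter error. There are $\bar\gamma_1,\bar\gamma_2>0$ such that for all $\gamma_1>\bar\gamma_1$ and $\gamma_2>\bar\gamma_2$ there is $\kappa_1>0$ such that for all $k_1>\kappa_1$ the following holds. For every solution of the closed loop on an interval $[t_0,T)$, $T\le\infty$, that satisfies the assumptions, has these initial values and has $\|\tilde r_2(t_0)\|\le B$ (with $B=2\|r_2(t_0)\|$ this admits the initialization $\hat v(t_0)=v(t_0)$), $e_p$ and $v$ are bounded on $[t_0,T)$; and if $T=\infty$, then $\lim_{t\to\infty}e_p(t)=\lim_{t\to\infty}v(t)=0$. -/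

import Mathlib

namespace VTOL

noncomputable section

/-- `ℝ³` with the Euclidean norm. -/
abbrev E3 := EuclideanSpace ℝ (Fin 3)

/-- Real `3 × 3` matrices. -/
abbrev Mat3 := Matrix (Fin 3) (Fin 3) ℝ

/-- The matrix-vector product `A x` on `ℝ³`. -/
abbrev act (A : Mat3) (x : E3) : E3 := Matrix.toEuclideanLin A x

/-- `e₃ = (0, 0, 1)`. -/
def e3 : E3 := !₂[0, 0, 1]

/-- The skew-symmetric matrix `S(x)` with `S(x) y = x × y`. -/
def S (x : E3) : Mat3 :=
  !![0, -x 2, x 1;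
     x 2, 0, -x 0;
     -x 1, x 0, 0]

/-! ### Quaternions `Q = (η, q)`, with scalar part `Q.1` and vector part `Q.2` -/

/-- `Q` is a unit quaternion. -/
def IsUnitQuat (Q : ℝ × E3) : Prop := Q.1 ^ 2 + ‖Q.2‖ ^ 2 = 1

/-- The quaternion product. -/
def qmul (Q₁ Q₂ : ℝ × E3) : ℝ × E3 :=
  (Q₁.1 * Q₂.1 - inner ℝ Q₁.2 Q₂.2, Q₁.1 • Q₂.2 + Q₂.1 • Q₁.2 + act (S Q₁.2) Q₂.2)

/-- The inverse of a unit quaternion. -/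
def qinv (Q : ℝ × E3) : ℝ × E3 := (Q.1, -Q.2)

/-- The rotation matrix `R(Q) = I + 2 S(q)² - 2 η S(q)`. -/
def rot (Q : ℝ × E3) : Mat3 := 1 + (2 : ℝ) • S Q.2 ^ 2 - (2 * Q.1) • S Q.2

/-- The right-hand side `½ (-qᵀ ω, (η I + S(q)) ω)` of the attitude kinematics. -/
def quatRate (Q : ℝ × E3) (ω : E3) : ℝ × E3 :=
  (-(1 / 2) * inner ℝ Q.2 ω, (1 / 2 : ℝ) • (Q.1 • ω + act (S Q.2) ω))

/-! ### The bounded function `h` and its Jacobian `φ` -/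

/-- `h(u) = (1 + uᵀu)^{-1/2} u`. -/
def h (u : E3) : E3 := (Real.sqrt (1 + ‖u‖ ^ 2))⁻¹ • u

/-- `φ(u) = (1 + uᵀu)^{-3/2} (I - S(u)²)`. -/
def phi (u : E3) : Mat3 := ((Real.sqrt (1 + ‖u‖ ^ 2)) ^ 3)⁻¹ • (1 - S u ^ 2)

/-! ### Thrust and attitude extraction from a desired acceleration `μ` -/

/-- The thrust `‖μ - g e₃‖`. -/
def thrust (g : ℝ) (μ : E3) : ℝ := ‖μ - g • e3‖

/-- The scalar part of the desired attitude. -/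
def etaD (g : ℝ) (μ : E3) : ℝ :=
  Real.sqrt (1 / 2 * (1 + (g - inner ℝ e3 μ) / ‖μ - g • e3‖))

/-- The desired attitude `Q_d = (η_d, q_d)`. -/
def attD (g : ℝ) (μ : E3) : ℝ × E3 :=
  (etaD g μ, (1 / (2 * ‖μ - g • e3‖ * etaD g μ)) • act (S μ) e3)

/-- The matrix `M(μ)`, which gives the desired angular velocity `ω_d = M(μ_d) dμ_d/dt`. -/
def M (g : ℝ) (μ : E3) : Mat3 :=
  (1 / (4 * etaD g μ ^ 2 * thrust g μ ^ 4)) •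
    ((-(4 : ℝ) • (S μ * Matrix.vecMulVec e3 e3)
        + (4 * etaD g μ ^ 2 * thrust g μ) • S e3
        + (2 : ℝ) • S μ
        - (2 * inner ℝ e3 μ) • S e3) * S (μ - g • e3) ^ 2)

/-! ### The vehicle, the gains and the closed loop -/

/-- Data of the vehicle, its environment and its task. -/
structure Vehicle where
  /-- gravitational acceleration -/
  g : ℝ
  /-- constant magnetic field, in the inertial frame -/
  r₁ : E3
  /-- aerodynamic disturbance, as a function of the translational velocity -/
  δ : E3 → E3
  /-- constant reference position -/
  pr : E3

/-- The control gains. -/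
structure Gains where
  kp : ℝ
  kv : ℝ
  γ₁ : ℝ
  γ₂ : ℝ
  k₁ : ℝ

/-- Position, velocity, attitude and filter variable. -/
structure State where
  p : E3
  v : E3
  Q : ℝ × E3
  vhat : E3

section ClosedLoop

variable (P : Vehicle) (K : Gains) (X : State)

/-- Position error `e_p = p - p_r`. -/
def eP : E3 := X.p - P.pr

/-- Virtual control law `μ_d = -k_p h(e_p) - k_v h(v)`. -/
def muD : E3 := -(K.kp • h (eP P X)) - K.kv • h X.v

/-- Thrust input `u_t = ‖μ_d - g e₃‖`. -/
def uT : ℝ := thrust P.g (muD P K X)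

/-- Desired attitude `Q_d`. -/
def QD : ℝ × E3 := attD P.g (muD P K X)

/-- `R_d = R(Q_d)`. -/
def RD : Mat3 := rot (QD P K X)

/-- Attitude error `Q̃ = Q ⊙ Q_d⁻¹`. -/
def Qerr : ℝ × E3 := qmul X.Q (qinv (QD P K X))

/-- Apparent acceleration `r₂ = -u_t Rᵀ e₃ + δ`. -/
def r2 : E3 := -(uT P K X • act (rot X.Q).transpose e3) + P.δ X.v

/-- Magnetometer signal `b₁ = R r₁`. -/
def b1 : E3 := act (rot X.Q) P.r₁

/-- Accelerometer signal `b₂ = R r₂`. -/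
def b2 : E3 := act (rot X.Q) (r2 P K X)

/-- `ψ = γ₁ S(R_d r₁) b₁ + γ₂ k₁ S(R_d (v - v̂)) b₂`. -/
def psi : E3 :=
  K.γ₁ • act (S (act (RD P K X) P.r₁)) (b1 P X)
    + (K.γ₂ * K.k₁) • act (S (act (RD P K X) (X.v - X.vhat))) (b2 P K X)

/-- `f_{μ_d} = -k_p φ(e_p) v + k_v φ(v) (k_p h(e_p) + k_v h(v))`. -/
def fMuD : E3 :=
  -(K.kp • act (phi (eP P X)) X.v)
    + K.kv • act (phi X.v) (K.kp • h (eP P X) + K.kv • h X.v)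

/-- The angular velocity input
`ω = M(μ_d) (f_{μ_d} - k_v φ(v) R_dᵀ (b₂ + u_t e₃)) + ψ`. -/
def omega : E3 :=
  act (M P.g (muD P K X))
      (fMuD P K X
        - K.kv • act (phi X.v) (act (RD P K X).transpose (b2 P K X + uT P K X • e3)))
    + psi P K X

/-- Right-hand side of the filter equation for `v̂`. -/
def vhatRate : E3 :=
  P.g • e3 + act (RD P K X).transpose (b2 P K X) + K.k₁ • (X.v - X.vhat)
    + (1 / K.k₁) • act (RD P K X).transpose (act (S (b2 P K X)) (psi P K X))

/-- The filter error `r̃₂ = k₁ (v - v̂) - (I - R̃) r₂`, where `R̃ = R(Q̃)`. -/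
def r2err : E3 :=
  K.k₁ • (X.v - X.vhat) - act (1 - rot (Qerr P K X)) (r2 P K X)

end ClosedLoop

/-- The time interval `[t₀, T)`, where `T = ⊤` gives `[t₀, ∞)`. -/
def timeInterval (t₀ : ℝ) (T : EReal) : Set ℝ := {t | t₀ ≤ t ∧ (t : EReal) < T}

/-- `x` solves the closed-loop system on the time interval `J`. -/
structure IsSolution (P : Vehicle) (K : Gains) (J : Set ℝ) (x : ℝ → State) : Prop where
  position : ∀ t ∈ J, HasDerivWithinAt (fun s => (x s).p) (x t).v J t
  velocity : ∀ t ∈ J, HasDerivWithinAt (fun s => (x s).v)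
    (P.g • e3 - uT P K (x t) • act (rot (x t).Q).transpose e3 + P.δ (x t).v) J t
  attitude : ∀ t ∈ J, HasDerivWithinAt (fun s => (x s).Q)
    (quatRate (x t).Q (omega P K (x t))) J t
  filter : ∀ t ∈ J, HasDerivWithinAt (fun s => (x s).vhat) (vhatRate P K (x t)) J t

/-! ### The assumptions -/

/-- `W = -a S(r₁)² - b S(r₂)²`. -/
def W (a b : ℝ) (r₁ r₂ : E3) : Mat3 := -(a • S r₁ ^ 2) - b • S r₂ ^ 2

/-- The smallest eigenvalue of a real symmetric matrix. -/
def lambdaMin (A : Mat3) : ℝ := sInf (spectrum ℝ A)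

/-- The apparent acceleration is uniformly non-collinear to the magnetic field along `x`:
for all positive weights `a`, `b`, the number `cw a b` is a strict lower bound of the smallest
eigenvalue of `W`. -/
def NonCollinear (cw : ℝ → ℝ → ℝ) (P : Vehicle) (K : Gains) (J : Set ℝ) (x : ℝ → State) :
    Prop :=
  ∀ a b : ℝ, 0 < a → 0 < b → ∀ t ∈ J, cw a b < lambdaMin (W a b P.r₁ (r2 P K (x t)))

/-- Along `x` the aerodynamic disturbance is differentiable in time, and its derivative
satisfies `‖dδ/dt‖ < c₂ + c₃ ‖v‖³`. -/
def DisturbanceRate (c₂ c₃ : ℝ) (P : Vehicle) (J : Set ℝ) (x : ℝ → State) : Prop :=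
  ∀ t ∈ J, DifferentiableWithinAt ℝ (fun s => P.δ (x s).v) J t ∧
    ‖derivWithin (fun s => P.δ (x s).v) J t‖ < c₂ + c₃ * ‖(x t).v‖ ^ 3

end

end VTOL

/-!
The closed loop is a cascade. The attitude error `q̃` and the filter error `r̃₂` form the inner
loop. In the rate of `‖q̃‖² + a ‖r̃₂‖²` the injection `ψ` contributes `-η̃² q̃ᵀ W q̃`, where the
weights of `W` grow with `γ₁` and `γ₂` and non-collinearity keeps `W` positive definite, while the
filter contributes `-2 a k₁ ‖r̃₂‖²`. As long as `v` is bounded and `η̃` stays away from `0`, large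
gains `γ` therefore dominate the terms in `q̃`, after which a large `k₁` dominates those in `r̃₂`,
and this Lyapunov function decays at any prescribed rate.

In the outer loop the energy `k_p (√(1 + ‖e_p‖²) - 1) + ½ ‖v‖²` is dissipated by `k_v h(v)` up to a
coupling to `q̃`. If the inner loop is fast enough, then the sum of the energy and half the inner
Lyapunov function does not increase for as long as the bounds on `v` and `η̃` hold, and this
monotonicity keeps both bounds strict, so that a continuity argument extends them to all times.

Boundedness makes `h` comparable to the identity along the solution. Adding a small multiple of
`⟨e_p, v⟩` and a large multiple of the inner Lyapunov function to the energy gives a function with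
negative definite rate, hence exponential convergence.
-/

namespace VTOL

noncomputable section

/-! ### The cross product on `ℝ³` -/

/-- The cross product on `ℝ³` with its Euclidean norm, as a continuous bilinear map, so that
linearity and the product rule for derivatives come from the library. -/
def cross : E3 →L[ℝ] E3 →L[ℝ] E3 :=
  ((crossProduct.compl₁₂ (WithLp.linearEquiv 2 ℝ (Fin 3 → ℝ)).toLinearMap
    (WithLp.linearEquiv 2 ℝ (Fin 3 → ℝ)).toLinearMap).compr₂
      (WithLp.linearEquiv 2 ℝ (Fin 3 → ℝ)).symm.toLinearMap).toContinuousBilinearMap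

@[simp] lemma cross_apply_zero (x y : E3) : cross x y 0 = x 1 * y 2 - x 2 * y 1 := rfl

@[simp] lemma cross_apply_one (x y : E3) : cross x y 1 = x 2 * y 0 - x 0 * y 2 := rfl

@[simp] lemma cross_apply_two (x y : E3) : cross x y 2 = x 0 * y 1 - x 1 * y 0 := rfl

@[simp] lemma e3_apply_zero : e3 0 = 0 := rfl

@[simp] lemma e3_apply_one : e3 1 = 0 := rfl

@[simp] lemma e3_apply_two : e3 2 = 1 := rfl

lemma ext_coord {x y : E3} (h₀ : x 0 = y 0) (h₁ : x 1 = y 1) (h₂ : x 2 = y 2) : x = y := by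
  ext i; fin_cases i <;> assumption

lemma inner_coord (x y : E3) : inner ℝ x y = x 0 * y 0 + x 1 * y 1 + x 2 * y 2 := by
  simp [PiLp.inner_apply, Fin.sum_univ_three, mul_comm]

lemma norm_sq_coord (x : E3) : ‖x‖ ^ 2 = x 0 ^ 2 + x 1 ^ 2 + x 2 ^ 2 := by
  rw [EuclideanSpace.real_norm_sq_eq, Fin.sum_univ_three]

lemma inner_e3 (x : E3) : inner ℝ e3 x = x 2 := by simp [inner_coord]

lemma norm_e3 : ‖e3‖ = 1 := by
  rw [← sq_eq_sq₀ (norm_nonneg _) zero_le_one, norm_sq_coord]; simp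

lemma cross_self (x : E3) : cross x x = 0 := by
  apply ext_coord <;> simp <;> ring

lemma cross_anticomm (x y : E3) : cross x y = -cross y x := by
  apply ext_coord <;> simp <;> ring

lemma inner_left_cross (x y : E3) : inner ℝ x (cross x y) = 0 := by
  simp only [inner_coord, cross_apply_zero, cross_apply_one, cross_apply_two]; ring

lemma inner_right_cross (x y : E3) : inner ℝ y (cross x y) = 0 := by
  simp only [inner_coord, cross_apply_zero, cross_apply_one, cross_apply_two]; ring

lemma cross_cross (x y z : E3) : cross x (cross y z) = inner ℝ x z • y - inner ℝ x y • z := by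
  apply ext_coord <;> simp [inner_coord] <;> ring

lemma norm_cross_sq (x y : E3) : ‖cross x y‖ ^ 2 = ‖x‖ ^ 2 * ‖y‖ ^ 2 - inner ℝ x y ^ 2 := by
  simp only [norm_sq_coord, inner_coord, cross_apply_zero, cross_apply_one, cross_apply_two]; ring

lemma norm_cross_le (x y : E3) : ‖cross x y‖ ≤ ‖x‖ * ‖y‖ := by
  refine le_of_sq_le_sq ?_ (by positivity)
  rw [norm_cross_sq, mul_pow]
  exact sub_le_self _ (sq_nonneg _)

/-! ### Matrices acting on `ℝ³` -/

lemma act_add (A B : Mat3) (x : E3) : act (A + B) x = act A x + act B x := by simp [act]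

lemma act_sub (A B : Mat3) (x : E3) : act (A - B) x = act A x - act B x := by simp [act]

lemma act_smul (c : ℝ) (A : Mat3) (x : E3) : act (c • A) x = c • act A x := by simp [act]

lemma act_one (x : E3) : act 1 x = x := by simp [act]

lemma act_add_right (A : Mat3) (x y : E3) : act A (x + y) = act A x + act A y := map_add _ x y

lemma act_sub_right (A : Mat3) (x y : E3) : act A (x - y) = act A x - act A y := map_sub _ x y

lemma act_neg_right (A : Mat3) (x : E3) : act A (-x) = -act A x := map_neg _ x

lemma act_smul_right (A : Mat3) (c : ℝ) (x : E3) : act A (c • x) = c • act A x := map_smul _ c x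

lemma act_mul (A B : Mat3) (x : E3) : act (A * B) x = act A (act B x) := by simp [act]

lemma act_vecMulVec (a b x : E3) : act (Matrix.vecMulVec a b) x = inner ℝ b x • a := by
  apply ext_coord <;>
    simp [act, inner_coord, Matrix.toLpLin_apply, Matrix.mulVec, dotProduct,
      Matrix.vecMulVec_apply, Fin.sum_univ_three] <;> ring

lemma inner_act_transpose (A : Mat3) (x y : E3) :
    inner ℝ (act A.transpose x) y = inner ℝ x (act A y) := by
  simp only [act, inner_coord, Matrix.toLpLin_apply, Matrix.mulVec, dotProduct,
    Fin.sum_univ_three, Matrix.transpose_apply]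
  ring

lemma act_S (x y : E3) : act (S x) y = cross x y := by
  apply ext_coord <;> simp [act, S, Matrix.toLpLin_apply, dotProduct, Fin.sum_univ_three] <;> ring

lemma act_S_sq (x y : E3) : act (S x ^ 2) y = cross x (cross x y) := by
  rw [pow_two, act_mul, act_S, act_S]

lemma S_neg (x : E3) : S (-x) = -S x := by
  ext i j; fin_cases i <;> fin_cases j <;> simp [S]

lemma S_transpose (x : E3) : (S x).transpose = -S x := by
  ext i j; fin_cases i <;> fin_cases j <;> simp [S]

/-! ### Unit quaternions and rotations -/

lemma act_rot (Q : ℝ × E3) (y : E3) :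
    act (rot Q) y = y + (2 : ℝ) • cross Q.2 (cross Q.2 y) - (2 * Q.1) • cross Q.2 y := by
  rw [rot, act_sub, act_add, act_smul, act_smul, act_one, act_S_sq, act_S]

lemma rot_transpose (Q : ℝ × E3) : (rot Q).transpose = rot (qinv Q) := by
  simp [rot, qinv, S_transpose, S_neg, Matrix.transpose_pow]

lemma qinv_qinv (Q : ℝ × E3) : qinv (qinv Q) = Q := by simp [qinv]

lemma IsUnitQuat.qinv {Q : ℝ × E3} (hQ : IsUnitQuat Q) : IsUnitQuat (qinv Q) := by
  simpa [IsUnitQuat, VTOL.qinv] using hQ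

lemma qmul_norm_sq (Q₁ Q₂ : ℝ × E3) :
    (qmul Q₁ Q₂).1 ^ 2 + ‖(qmul Q₁ Q₂).2‖ ^ 2
      = (Q₁.1 ^ 2 + ‖Q₁.2‖ ^ 2) * (Q₂.1 ^ 2 + ‖Q₂.2‖ ^ 2) := by
  simp only [qmul, norm_sq_coord, inner_coord, act_S, PiLp.add_apply, PiLp.smul_apply,
    smul_eq_mul, cross_apply_zero, cross_apply_one, cross_apply_two]
  ring

lemma IsUnitQuat.qmul {Q₁ Q₂ : ℝ × E3} (h₁ : IsUnitQuat Q₁) (h₂ : IsUnitQuat Q₂) :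
    IsUnitQuat (qmul Q₁ Q₂) := by
  rw [IsUnitQuat] at *
  rw [qmul_norm_sq, h₁, h₂, one_mul]

lemma IsUnitQuat.fst_sq {Q : ℝ × E3} (hQ : IsUnitQuat Q) : Q.1 ^ 2 = 1 - ‖Q.2‖ ^ 2 :=
  eq_sub_of_add_eq hQ

lemma IsUnitQuat.norm_snd_le_one {Q : ℝ × E3} (hQ : IsUnitQuat Q) : ‖Q.2‖ ≤ 1 := by
  nlinarith [hQ.fst_sq, norm_nonneg Q.2]

lemma IsUnitQuat.abs_fst_le_one {Q : ℝ × E3} (hQ : IsUnitQuat Q) : |Q.1| ≤ 1 :=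
  abs_le_one_iff_mul_self_le_one.2 (by nlinarith [hQ.fst_sq])

lemma IsUnitQuat.act_rot_eq {Q : ℝ × E3} (hQ : IsUnitQuat Q) (y : E3) :
    act (rot Q) y
      = (Q.1 ^ 2 - ‖Q.2‖ ^ 2) • y + (2 * inner ℝ Q.2 y) • Q.2 - (2 * Q.1) • cross Q.2 y := by
  rw [act_rot, cross_cross, real_inner_self_eq_norm_sq, hQ.fst_sq]
  module

lemma IsUnitQuat.act_rot_qmul {Q₁ Q₂ : ℝ × E3} (h₁ : IsUnitQuat Q₁) (h₂ : IsUnitQuat Q₂)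
    (y : E3) : act (rot (VTOL.qmul Q₁ Q₂)) y = act (rot Q₂) (act (rot Q₁) y) := by
  rw [(h₁.qmul h₂).act_rot_eq, h₂.act_rot_eq, h₁.act_rot_eq]
  apply ext_coord <;>
  · simp only [VTOL.qmul, act_S, norm_sq_coord, inner_coord, PiLp.add_apply, PiLp.sub_apply,
      PiLp.smul_apply, smul_eq_mul, cross_apply_zero, cross_apply_one, cross_apply_two]
    ring

lemma IsUnitQuat.qmul_qinv {Q : ℝ × E3} (hQ : IsUnitQuat Q) :
    VTOL.qmul Q (VTOL.qinv Q) = (1, 0) := by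
  ext1
  · simpa [VTOL.qmul, VTOL.qinv, ← pow_two] using show Q.1 ^ 2 + ‖Q.2‖ ^ 2 = 1 from hQ
  · simp [VTOL.qmul, VTOL.qinv, act_S, cross_self]

lemma IsUnitQuat.act_rot_transpose_rot {Q : ℝ × E3} (hQ : IsUnitQuat Q) (y : E3) :
    act (rot Q).transpose (act (rot Q) y) = y := by
  rw [rot_transpose, ← hQ.act_rot_qmul hQ.qinv, hQ.qmul_qinv, act_rot]
  simp

lemma IsUnitQuat.act_rot_rot_transpose {Q : ℝ × E3} (hQ : IsUnitQuat Q) (y : E3) :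
    act (rot Q) (act (rot Q).transpose y) = y := by
  have h := hQ.qinv.act_rot_transpose_rot y
  rwa [rot_transpose, qinv_qinv, ← rot_transpose] at h

lemma IsUnitQuat.norm_rot {Q : ℝ × E3} (hQ : IsUnitQuat Q) (y : E3) : ‖act (rot Q) y‖ = ‖y‖ := by
  rw [← sq_eq_sq₀ (norm_nonneg _) (norm_nonneg _), ← real_inner_self_eq_norm_sq,
    ← inner_act_transpose, hQ.act_rot_transpose_rot, real_inner_self_eq_norm_sq]

lemma IsUnitQuat.norm_rot_transpose {Q : ℝ × E3} (hQ : IsUnitQuat Q) (y : E3) :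
    ‖act (rot Q).transpose y‖ = ‖y‖ := by
  rw [rot_transpose, hQ.qinv.norm_rot]

lemma IsUnitQuat.rot_cross {Q : ℝ × E3} (hQ : IsUnitQuat Q) (x y : E3) :
    act (rot Q) (cross x y) = cross (act (rot Q) x) (act (rot Q) y) := by
  have homogeneous : act (rot Q) (cross x y)
      = (Q.1 ^ 2 + ‖Q.2‖ ^ 2) • act (rot Q) (cross x y) := by
    rw [show Q.1 ^ 2 + ‖Q.2‖ ^ 2 = 1 from hQ, one_smul]
  rw [homogeneous, hQ.act_rot_eq, hQ.act_rot_eq, hQ.act_rot_eq]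
  apply ext_coord <;>
  · simp only [norm_sq_coord, inner_coord, PiLp.add_apply, PiLp.sub_apply,
      PiLp.smul_apply, smul_eq_mul, cross_apply_zero, cross_apply_one, cross_apply_two]
    ring

lemma IsUnitQuat.norm_sub_rot_le {Q : ℝ × E3} (hQ : IsUnitQuat Q) (y : E3) :
    ‖y - act (rot Q) y‖ ≤ 2 * ‖Q.2‖ * ‖y‖ := by
  have factor : y - act (rot Q) y = (2 : ℝ) • (Q.1 • cross Q.2 y - cross Q.2 (cross Q.2 y)) := by
    rw [act_rot]; module
  have chord : ‖y - act (rot Q) y‖ ^ 2 = (2 * ‖cross Q.2 y‖) ^ 2 := by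
    rw [factor, norm_smul, mul_pow, norm_sub_sq_real, real_inner_smul_left, inner_right_cross,
      norm_smul, mul_pow, norm_cross_sq Q.2 (cross Q.2 y), inner_left_cross, Real.norm_eq_abs,
      Real.norm_eq_abs, sq_abs, sq_abs, hQ.fst_sq]
    ring
  rw [(sq_eq_sq₀ (norm_nonneg _) (by positivity)).1 chord]
  linarith [norm_cross_le Q.2 y]

/-! ### The saturation `h` -/

lemma one_le_sqrt_one_add_norm_sq (u : E3) : 1 ≤ √(1 + ‖u‖ ^ 2) :=
  Real.one_le_sqrt.2 (le_add_of_nonneg_right (sq_nonneg _))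

lemma sqrt_one_add_norm_sq_pos (u : E3) : 0 < √(1 + ‖u‖ ^ 2) :=
  zero_lt_one.trans_le (one_le_sqrt_one_add_norm_sq u)

lemma norm_h (u : E3) : ‖h u‖ = ‖u‖ / √(1 + ‖u‖ ^ 2) := by
  rw [h, norm_smul, norm_inv, Real.norm_of_nonneg (Real.sqrt_nonneg _), inv_mul_eq_div]

lemma norm_h_le_one (u : E3) : ‖h u‖ ≤ 1 := by
  rw [norm_h, div_le_one (sqrt_one_add_norm_sq_pos u)]
  exact Real.le_sqrt_of_sq_le (by linarith)

lemma norm_h_le (u : E3) : ‖h u‖ ≤ ‖u‖ := by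
  rw [norm_h]
  exact div_le_self (norm_nonneg u) (one_le_sqrt_one_add_norm_sq u)

lemma inner_self_h (u : E3) : inner ℝ u (h u) = ‖u‖ ^ 2 / √(1 + ‖u‖ ^ 2) := by
  rw [h, inner_smul_right, real_inner_self_eq_norm_sq, inv_mul_eq_div]

lemma act_phi (u y : E3) :
    act (phi u) y = ((√(1 + ‖u‖ ^ 2)) ^ 3)⁻¹ • (y - cross u (cross u y)) := by
  rw [phi, act_smul, act_sub, act_one, act_S_sq]

lemma norm_phi_le (u y : E3) : ‖act (phi u) y‖ ≤ ‖y‖ := by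
  have one_le := one_le_sqrt_one_add_norm_sq u
  have sq_eq : √(1 + ‖u‖ ^ 2) ^ 2 = 1 + ‖u‖ ^ 2 := Real.sq_sqrt (by positivity)
  rw [act_phi, norm_smul, norm_inv, norm_pow, Real.norm_of_nonneg (Real.sqrt_nonneg _),
    inv_mul_le_iff₀ (by positivity)]
  calc ‖y - cross u (cross u y)‖ ≤ ‖y‖ + ‖u‖ * (‖u‖ * ‖y‖) := by
        refine (norm_sub_le _ _).trans ?_
        gcongr
        exact (norm_cross_le _ _).trans (by gcongr; exact norm_cross_le _ _)
    _ = √(1 + ‖u‖ ^ 2) ^ 2 * ‖y‖ := by rw [sq_eq]; ring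
    _ ≤ √(1 + ‖u‖ ^ 2) ^ 3 * ‖y‖ := by gcongr; norm_num

lemma hasDerivWithinAt_sqrt_one_add_norm_sq {u : ℝ → E3} {u' : E3} {J : Set ℝ} {t : ℝ}
    (hu : HasDerivWithinAt u u' J t) :
    HasDerivWithinAt (fun s => √(1 + ‖u s‖ ^ 2)) (inner ℝ (h (u t)) u') J t := by
  refine ((hu.norm_sq.const_add 1).sqrt (by positivity)).congr_deriv ?_
  rw [h, real_inner_smul_left]
  field_simp

lemma hasDerivWithinAt_h {u : ℝ → E3} {u' : E3} {J : Set ℝ} {t : ℝ}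
    (hu : HasDerivWithinAt u u' J t) :
    HasDerivWithinAt (fun s => h (u s)) (act (phi (u t)) u') J t := by
  have pos := sqrt_one_add_norm_sq_pos (u t)
  have norm_sq_eq : ‖u t‖ ^ 2 = √(1 + ‖u t‖ ^ 2) ^ 2 - 1 :=
    eq_sub_of_add_eq' (Real.sq_sqrt (by positivity)).symm
  have deriv : HasDerivWithinAt (fun s => h (u s)) ((√(1 + ‖u t‖ ^ 2))⁻¹ • u'
      + (-inner ℝ (h (u t)) u' / √(1 + ‖u t‖ ^ 2) ^ 2) • u t) J t :=
    ((hasDerivWithinAt_sqrt_one_add_norm_sq hu).inv pos.ne').smul hu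
  refine deriv.congr_deriv ?_
  rw [act_phi, cross_cross, real_inner_self_eq_norm_sq, h, real_inner_smul_left]
  clear deriv
  generalize √(1 + ‖u t‖ ^ 2) = r at *
  rw [norm_sq_eq]
  match_scalars <;> simp <;> field_simp

/-! ### The quaternion that aligns the thrust axis with a given direction -/

/-- The quaternion of the minimal rotation that aligns `e₃` with the unit vector `n ≠ -e₃`:
`R(Q)ᵀ e₃ = n`. The desired attitude is the one for the direction of thrust. -/
def alignQuat (n : E3) : ℝ × E3 :=
  (√(1 / 2 * (1 + n 2)), (1 / (2 * √(1 / 2 * (1 + n 2)))) • cross e3 n)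

/-- The angular velocity of `alignQuat n` when `n` moves on the unit sphere with velocity `n'`. -/
def alignRate (n n' : E3) : E3 :=
  (1 + n 2)⁻¹ • ((2 * n' 2) • cross n e3 + (1 + 2 * n 2) • cross e3 n' - cross n n')

lemma alignQuat_fst_sq {n : E3} (hn₃ : -1 < n 2) :
    (alignQuat n).1 ^ 2 = 1 / 2 * (1 + n 2) :=
  Real.sq_sqrt (by linarith)

lemma alignQuat_fst_pos {n : E3} (hn₃ : -1 < n 2) : 0 < (alignQuat n).1 :=
  Real.sqrt_pos.2 (by linarith)

lemma alignQuat_snd (n : E3) : (alignQuat n).2 = (1 / (2 * (alignQuat n).1)) • cross e3 n := rfl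

lemma isUnitQuat_alignQuat {n : E3} (hn : ‖n‖ = 1) (hn₃ : -1 < n 2) :
    IsUnitQuat (alignQuat n) := by
  have η_sq := alignQuat_fst_sq hn₃
  have η_pos := alignQuat_fst_pos hn₃
  rw [IsUnitQuat, alignQuat_snd, norm_smul, mul_pow, norm_cross_sq, inner_e3, norm_e3, hn,
    Real.norm_of_nonneg (by positivity), eq_sub_of_add_eq' (show 1 + n 2 = 2 * (alignQuat n).1 ^ 2
      by linarith)]
  field_simp
  ring

lemma act_rot_transpose (Q : ℝ × E3) (y : E3) :
    act (rot Q).transpose y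
      = y + (2 : ℝ) • cross Q.2 (cross Q.2 y) + (2 * Q.1) • cross Q.2 y := by
  simp [rot_transpose, act_rot, qinv]

lemma act_rot_alignQuat_transpose_e3 {n : E3} (hn : ‖n‖ = 1) (hn₃ : -1 < n 2) :
    act (rot (alignQuat n)).transpose e3 = n := by
  have η_sq := alignQuat_fst_sq hn₃
  have η_ne := (alignQuat_fst_pos hn₃).ne'
  have q_sq : ‖(alignQuat n).2‖ ^ 2 = 1 - (alignQuat n).1 ^ 2 :=
    eq_sub_of_add_eq' (isUnitQuat_alignQuat hn hn₃)
  have q_orthogonal : inner ℝ (alignQuat n).2 e3 = 0 := by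
    rw [alignQuat_snd, real_inner_smul_left, real_inner_comm, inner_left_cross, mul_zero]
  have q_cross : (2 * (alignQuat n).1) • cross (alignQuat n).2 e3 = n - n 2 • e3 := by
    rw [alignQuat_snd, map_smul, smul_apply, smul_smul,
      mul_one_div_cancel (mul_ne_zero two_ne_zero η_ne), one_smul, cross_anticomm, cross_cross,
      inner_e3, real_inner_self_eq_norm_sq, norm_e3]
    module
  rw [act_rot_transpose, q_cross, cross_cross, q_orthogonal, real_inner_self_eq_norm_sq, q_sq,
    η_sq]
  module

lemma norm_alignRate_le {n : E3} (hn : ‖n‖ = 1) (hn₃ : 0 ≤ n 2) (n' : E3) :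
    ‖alignRate n n'‖ ≤ 4 * ‖n'‖ := by
  have cross_n_e3 : ‖cross n e3‖ ≤ 1 := by simpa [hn, norm_e3] using norm_cross_le n e3
  have cross_e3_n' : ‖cross e3 n'‖ ≤ ‖n'‖ := by simpa [norm_e3] using norm_cross_le e3 n'
  have cross_n_n' : ‖cross n n'‖ ≤ ‖n'‖ := by simpa [hn] using norm_cross_le n n'
  have n'_apply : ‖n' 2‖ ≤ ‖n'‖ := PiLp.norm_apply_le n' 2
  rw [alignRate, norm_smul, norm_inv, Real.norm_of_nonneg (by positivity),
    inv_mul_le_iff₀ (by positivity)]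
  calc _ ≤ 2 * ‖n' 2‖ * ‖cross n e3‖ + (1 + 2 * n 2) * ‖cross e3 n'‖ + ‖cross n n'‖ := by
        refine (norm_sub_le _ _).trans (add_le_add_left ((norm_add_le _ _).trans_eq ?_) _)
        rw [norm_smul, norm_smul, norm_mul, Real.norm_ofNat,
          Real.norm_of_nonneg (show 0 ≤ 1 + 2 * n 2 by positivity)]
    _ ≤ 2 * ‖n'‖ * 1 + (1 + 2 * n 2) * ‖n'‖ + ‖n'‖ := by gcongr
    _ ≤ (1 + n 2) * (4 * ‖n'‖) := by nlinarith [mul_nonneg hn₃ (norm_nonneg n')]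

lemma hasDerivWithinAt_apply {n : ℝ → E3} {n' : E3} {J : Set ℝ} {t : ℝ}
    (hn : HasDerivWithinAt n n' J t) (i : Fin 3) :
    HasDerivWithinAt (fun s => n s i) (n' i) J t :=
  (EuclideanSpace.proj (𝕜 := ℝ) i).hasFDerivAt.comp_hasDerivWithinAt t hn

lemma hasDerivWithinAt_alignQuat_fst {n : ℝ → E3} {n' : E3} {J : Set ℝ} {t : ℝ}
    (hn : HasDerivWithinAt n n' J t) (hn₃ : -1 < n t 2) :
    HasDerivWithinAt (fun s => (alignQuat (n s)).1) (n' 2 / (4 * (alignQuat (n t)).1)) J t := by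
  have arg_pos : 0 < 1 / 2 * (1 + n t 2) := by linarith
  refine ((((hasDerivWithinAt_apply hn 2).const_add 1).const_mul (1 / 2)).sqrt
    arg_pos.ne').congr_deriv ?_
  rw [show √(1 / 2 * (1 + n t 2)) = (alignQuat (n t)).1 from rfl]
  ring

lemma quatRate_alignQuat {n n' : E3} (hn : ‖n‖ = 1) (hn₃ : -1 < n 2) (hn' : inner ℝ n n' = 0) :
    quatRate (alignQuat n) (alignRate n n')
      = (n' 2 / (4 * (alignQuat n).1),
          (1 / (2 * (alignQuat n).1)) • cross e3 n'
            - (n' 2 / (8 * (alignQuat n).1 ^ 3)) • cross e3 n) := by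
  have η_pos := alignQuat_fst_pos hn₃
  have n_apply_two : n 2 = 2 * (alignQuat n).1 ^ 2 - 1 := by linarith [alignQuat_fst_sq hn₃]
  have n_sq := norm_sq_coord n
  rw [hn, n_apply_two] at n_sq
  rw [inner_coord, n_apply_two] at hn'
  simp only [quatRate, alignRate, act_S, alignQuat_snd, n_apply_two]
  generalize (alignQuat n).1 = η at *
  refine Prod.ext ?_ (ext_coord ?_ ?_ ?_) <;>
    simp only [inner_coord, map_smul, map_sub, map_add, PiLp.add_apply, PiLp.sub_apply,
      PiLp.smul_apply, smul_apply, smul_eq_mul, cross_apply_zero, cross_apply_one,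
      cross_apply_two, e3_apply_zero, e3_apply_one, e3_apply_two, n_apply_two, add_sub_cancel]
  · field_simp
    linear_combination -4 * n' 2 * n_sq - 8 * η ^ 2 * hn'
  · field_simp
    linear_combination 8 * n' 1 * n_sq + 8 * n 1 * hn'
  · field_simp
    linear_combination -8 * n' 0 * n_sq - 8 * n 0 * hn'
  · field_simp
    ring

lemma hasDerivWithinAt_alignQuat {n : ℝ → E3} {n' : E3} {J : Set ℝ} {t : ℝ}
    (hn : HasDerivWithinAt n n' J t) (norm_n : ‖n t‖ = 1) (hn₃ : -1 < n t 2)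
    (hn' : inner ℝ (n t) n' = 0) :
    HasDerivWithinAt (fun s => alignQuat (n s))
      (quatRate (alignQuat (n t)) (alignRate (n t) n')) J t := by
  have η_pos := alignQuat_fst_pos hn₃
  have fst_deriv := hasDerivWithinAt_alignQuat_fst hn hn₃
  have coeff_deriv : HasDerivWithinAt (fun s => 1 / (2 * (alignQuat (n s)).1))
      (-(n' 2 / (8 * (alignQuat (n t)).1 ^ 3))) J t := by
    refine (((fst_deriv.const_mul 2).inv (by positivity)).congr_deriv ?_).congr (fun s _ => ?_) ?_
    · field_simp; ring
    · exact one_div _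
    · exact one_div _
  rw [quatRate_alignQuat norm_n hn₃ hn']
  have cross_deriv : HasDerivWithinAt (fun s => cross e3 (n s)) (cross e3 n') J t :=
    (cross e3).hasFDerivAt.comp_hasDerivWithinAt t hn
  refine fst_deriv.prodMk ((coeff_deriv.smul cross_deriv).congr_deriv ?_)
  rw [neg_smul, ← sub_eq_add_neg]

/-! ### Thrust and desired attitude -/

lemma thrust_le {g : ℝ} (hg : 0 ≤ g) (μ : E3) : thrust g μ ≤ g + ‖μ‖ := by
  simpa [thrust, norm_smul, norm_e3, abs_of_nonneg hg, add_comm] using norm_sub_le μ (g • e3)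

lemma le_thrust {g : ℝ} (hg : 0 ≤ g) (μ : E3) : g - ‖μ‖ ≤ thrust g μ := by
  simpa [thrust, norm_smul, norm_e3, abs_of_nonneg hg, norm_sub_rev]
    using norm_sub_norm_le (g • e3) μ

lemma thrust_pos {g : ℝ} {μ : E3} (hμ : ‖μ‖ < g) : 0 < thrust g μ :=
  (sub_pos.2 hμ).trans_le (le_thrust ((norm_nonneg μ).trans hμ.le) μ)

/-- The direction in which the thrust has to act to produce the acceleration `μ`. -/
def thrustDir (g : ℝ) (μ : E3) : E3 := (thrust g μ)⁻¹ • (g • e3 - μ)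

lemma thrust_smul_thrustDir {g : ℝ} {μ : E3} (hμ : ‖μ‖ < g) :
    thrust g μ • thrustDir g μ = g • e3 - μ :=
  smul_inv_smul₀ (thrust_pos hμ).ne' _

lemma norm_thrustDir {g : ℝ} {μ : E3} (hμ : ‖μ‖ < g) : ‖thrustDir g μ‖ = 1 := by
  have pos := thrust_pos hμ
  rw [thrustDir, norm_smul, norm_inv, Real.norm_of_nonneg pos.le, norm_sub_rev]
  exact inv_mul_cancel₀ pos.ne'

lemma thrustDir_apply_two (g : ℝ) (μ : E3) : thrustDir g μ 2 = (g - μ 2) / thrust g μ := by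
  simp [thrustDir, inv_mul_eq_div]

lemma thrustDir_apply_two_pos {g : ℝ} {μ : E3} (hμ : ‖μ‖ < g) : 0 < thrustDir g μ 2 := by
  rw [thrustDir_apply_two]
  exact div_pos (sub_pos.2 (((le_abs_self _).trans (PiLp.norm_apply_le μ 2)).trans_lt hμ))
    (thrust_pos hμ)

lemma attD_eq_alignQuat {g : ℝ} {μ : E3} (hμ : ‖μ‖ < g) : attD g μ = alignQuat (thrustDir g μ) := by
  have pos := thrust_pos hμ
  have η_eq : etaD g μ = (alignQuat (thrustDir g μ)).1 := by
    rw [etaD, alignQuat, thrustDir_apply_two, inner_e3, thrust]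
  have cross_eq : cross μ e3 = thrust g μ • cross e3 (thrustDir g μ) := by
    rw [← map_smul, thrust_smul_thrustDir hμ, map_sub, map_smul, cross_self, smul_zero, zero_sub,
      cross_anticomm]
  rw [attD, η_eq]
  refine Prod.ext rfl ?_
  rw [alignQuat_snd, act_S, cross_eq, smul_smul, ← thrust]
  field_simp

lemma isUnitQuat_attD {g : ℝ} {μ : E3} (hμ : ‖μ‖ < g) : IsUnitQuat (attD g μ) := by
  rw [attD_eq_alignQuat hμ]
  exact isUnitQuat_alignQuat (norm_thrustDir hμ) (by linarith [thrustDir_apply_two_pos hμ])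

lemma thrust_smul_rot_attD_transpose_e3 {g : ℝ} {μ : E3} (hμ : ‖μ‖ < g) :
    thrust g μ • act (rot (attD g μ)).transpose e3 = g • e3 - μ := by
  rw [attD_eq_alignQuat hμ, act_rot_alignQuat_transpose_e3 (norm_thrustDir hμ)
    (by linarith [thrustDir_apply_two_pos hμ]), thrust_smul_thrustDir hμ]

/-- The velocity of `thrustDir g μ` when `μ` moves with velocity `μ'`. -/
def thrustDirRate (g : ℝ) (μ μ' : E3) : E3 :=
  (thrust g μ)⁻¹ • cross (thrustDir g μ) (cross (thrustDir g μ) μ')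

lemma inner_thrustDir_thrustDirRate (g : ℝ) (μ μ' : E3) :
    inner ℝ (thrustDir g μ) (thrustDirRate g μ μ') = 0 := by
  rw [thrustDirRate, inner_smul_right, inner_left_cross, mul_zero]

lemma norm_thrustDirRate_le {g : ℝ} {μ : E3} (hμ : ‖μ‖ < g) (μ' : E3) :
    ‖thrustDirRate g μ μ'‖ ≤ ‖μ'‖ / thrust g μ := by
  have norm_cross_dir_le (x : E3) : ‖cross (thrustDir g μ) x‖ ≤ ‖x‖ := by
    simpa [norm_thrustDir hμ] using norm_cross_le (thrustDir g μ) x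
  have pos := thrust_pos hμ
  rw [thrustDirRate, norm_smul, norm_inv, Real.norm_of_nonneg pos.le, inv_mul_eq_div]
  gcongr
  exact (norm_cross_dir_le _).trans (norm_cross_dir_le _)

lemma hasDerivWithinAt_thrust {g : ℝ} {μ : ℝ → E3} {μ' : E3} {J : Set ℝ} {t : ℝ}
    (hμ : HasDerivWithinAt μ μ' J t) (hμg : ‖μ t‖ < g) :
    HasDerivWithinAt (fun s => thrust g (μ s)) (-inner ℝ (thrustDir g (μ t)) μ') J t := by
  have deriv := (hμ.sub_const (g • e3)).norm_sq.sqrt (pow_pos (thrust_pos hμg) 2).ne'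
  simp only [Real.sqrt_sq (norm_nonneg _)] at deriv
  refine deriv.congr_deriv ?_
  rw [thrustDir, real_inner_smul_left, ← neg_sub (μ t), inner_neg_left, thrust]
  ring

lemma hasDerivWithinAt_thrustDir {g : ℝ} {μ : ℝ → E3} {μ' : E3} {J : Set ℝ} {t : ℝ}
    (hμ : HasDerivWithinAt μ μ' J t) (hμg : ‖μ t‖ < g) :
    HasDerivWithinAt (fun s => thrustDir g (μ s)) (thrustDirRate g (μ t) μ') J t := by
  have pos := thrust_pos hμg
  have deriv : HasDerivWithinAt (fun s => thrustDir g (μ s))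
      ((thrust g (μ t))⁻¹ • -μ' + (-(-inner ℝ (thrustDir g (μ t)) μ') / thrust g (μ t) ^ 2) •
        (g • e3 - μ t)) J t :=
    ((hasDerivWithinAt_thrust hμ hμg).inv pos.ne').smul (hμ.const_sub (g • e3))
  refine deriv.congr_deriv ?_
  rw [thrustDirRate, cross_cross, real_inner_self_eq_norm_sq, norm_thrustDir hμg,
    ← thrust_smul_thrustDir hμg]
  match_scalars <;> field_simp

lemma act_M {g : ℝ} {μ : E3} (hμ : ‖μ‖ < g) (x : E3) :
    act (M g μ) x = alignRate (thrustDir g μ) (thrustDirRate g μ x) := by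
  have u_pos := thrust_pos hμ
  have n₃_pos := thrustDir_apply_two_pos hμ
  have μ_eq : μ = g • e3 - thrust g μ • thrustDir g μ := by
    rw [thrust_smul_thrustDir hμ, sub_sub_cancel]
  have μ_sub_eq : μ - g • e3 = -(thrust g μ • thrustDir g μ) := by
    rw [thrust_smul_thrustDir hμ, neg_sub]
  have η_sq : etaD g μ ^ 2 = 1 / 2 * (1 + thrustDir g μ 2) := by
    rw [← alignQuat_fst_sq (by linarith), ← attD_eq_alignQuat hμ]; rfl
  have S_sq : act (S (μ - g • e3) ^ 2) x = thrust g μ ^ 3 • thrustDirRate g μ x := by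
    rw [act_S_sq, μ_sub_eq, thrustDirRate]
    simp only [map_neg, map_smul, neg_apply, smul_apply]
    match_scalars; field_simp
  have inner_e3_μ : inner ℝ e3 μ = g - thrust g μ * thrustDir g μ 2 := by
    rw [inner_e3]; conv_lhs => rw [μ_eq]
    simp
  rw [M, act_smul, act_mul, S_sq, act_sub, act_add, act_add, act_smul, act_smul, act_smul,
    act_smul, act_mul, act_vecMulVec, act_S, act_S, act_S, η_sq, inner_e3_μ, inner_e3, alignRate]
  generalize thrustDirRate g μ x = n'
  generalize thrustDir g μ = n at *
  generalize thrust g μ = u at *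
  subst μ_eq
  simp only [map_smul, map_sub, sub_apply, smul_apply, cross_self]
  match_scalars <;> simp <;> field_simp <;> ring

lemma hasDerivWithinAt_attD {g : ℝ} {μ : ℝ → E3} {μ' : E3} {J : Set ℝ} {t : ℝ}
    (hμ : HasDerivWithinAt μ μ' J t) (hμg : ∀ s, ‖μ s‖ < g) :
    HasDerivWithinAt (fun s => attD g (μ s))
      (quatRate (attD g (μ t)) (act (M g (μ t)) μ')) J t := by
  simp only [attD_eq_alignQuat (hμg _), act_M (hμg _)]
  exact hasDerivWithinAt_alignQuat (hasDerivWithinAt_thrustDir hμ (hμg t))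
    (norm_thrustDir (hμg t)) (by linarith [thrustDir_apply_two_pos (hμg t)])
    (inner_thrustDir_thrustDirRate g (μ t) μ')

lemma norm_M_le {g k : ℝ} {μ : E3} (hμ : ‖μ‖ ≤ k) (hk : k < g) (x : E3) :
    ‖act (M g μ) x‖ ≤ 4 / (g - k) * ‖x‖ := by
  have hμg : ‖μ‖ < g := hμ.trans_lt hk
  have le_u := le_thrust ((norm_nonneg μ).trans hμg.le) μ
  rw [act_M hμg]
  calc _ ≤ 4 * ‖thrustDirRate g μ x‖ :=
        norm_alignRate_le (norm_thrustDir hμg) (thrustDir_apply_two_pos hμg).le _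
    _ ≤ 4 * (‖x‖ / thrust g μ) := by gcongr; exact norm_thrustDirRate_le hμg x
    _ ≤ 4 * (‖x‖ / (g - k)) := by gcongr; linarith
    _ = 4 / (g - k) * ‖x‖ := by ring

/-! ### Attitude kinematics -/

section Kinematics

variable {Q Qd : ℝ → ℝ × E3} {Q' : ℝ × E3} {y : ℝ → E3} {ω ωd y' : E3} {J : Set ℝ} {t : ℝ}

lemma hasDerivWithinAt_quat_fst (hQ : HasDerivWithinAt Q Q' J t) :
    HasDerivWithinAt (fun s => (Q s).1) Q'.1 J t :=
  (ContinuousLinearMap.fst ℝ ℝ E3).hasFDerivAt.comp_hasDerivWithinAt t hQ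

lemma hasDerivWithinAt_quat_snd (hQ : HasDerivWithinAt Q Q' J t) :
    HasDerivWithinAt (fun s => (Q s).2) Q'.2 J t :=
  (ContinuousLinearMap.snd ℝ ℝ E3).hasFDerivAt.comp_hasDerivWithinAt t hQ

lemma hasDerivWithinAt_act_rot (hQ : HasDerivWithinAt Q Q' J t) (hy : HasDerivWithinAt y y' J t) :
    HasDerivWithinAt (fun s => act (rot (Q s)) (y s))
      (act (rot (Q t)) y'
        + (2 : ℝ) • (cross (Q t).2 (cross Q'.2 (y t)) + cross Q'.2 (cross (Q t).2 (y t)))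
        - (2 * (Q t).1) • cross Q'.2 (y t) - (2 * Q'.1) • cross (Q t).2 (y t)) J t := by
  have fst_deriv := hasDerivWithinAt_quat_fst hQ
  have snd_deriv := hasDerivWithinAt_quat_snd hQ
  have cross_deriv := cross.hasDerivWithinAt_of_bilinear snd_deriv hy
  have cross_cross_deriv := cross.hasDerivWithinAt_of_bilinear snd_deriv cross_deriv
  simp only [act_rot]
  refine ((hy.add (cross_cross_deriv.const_smul (2 : ℝ))).sub
    ((fst_deriv.const_mul 2).smul cross_deriv)).congr_deriv ?_
  rw [map_add]
  module

lemma hasDerivWithinAt_act_rot_of_quatRate (hQ : HasDerivWithinAt Q (quatRate (Q t) ω) J t)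
    (hy : HasDerivWithinAt y y' J t) (hu : IsUnitQuat (Q t)) :
    HasDerivWithinAt (fun s => act (rot (Q s)) (y s))
      (act (rot (Q t)) y' - cross ω (act (rot (Q t)) (y t))) J t := by
  refine (hasDerivWithinAt_act_rot hQ hy).congr_deriv ?_
  rw [hu.act_rot_eq (y t), quatRate]
  generalize act (rot (Q t)) y' = z
  apply ext_coord <;>
  · simp only [act_S, norm_sq_coord, inner_coord, PiLp.add_apply, PiLp.sub_apply,
      PiLp.smul_apply, smul_eq_mul, cross_apply_zero, cross_apply_one, cross_apply_two]
    ring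

lemma hasDerivWithinAt_act_rot_transpose_of_quatRate
    (hQ : HasDerivWithinAt Q (quatRate (Q t) ω) J t) (hy : HasDerivWithinAt y y' J t)
    (hu : IsUnitQuat (Q t)) :
    HasDerivWithinAt (fun s => act (rot (Q s)).transpose (y s))
      (act (rot (Q t)).transpose (y' + cross ω (y t))) J t := by
  have qinv_deriv : HasDerivWithinAt (fun s => qinv (Q s))
      ((quatRate (Q t) ω).1, -(quatRate (Q t) ω).2) J t :=
    (hasDerivWithinAt_quat_fst hQ).prodMk (hasDerivWithinAt_quat_snd hQ).neg
  simp only [rot_transpose]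
  refine (hasDerivWithinAt_act_rot qinv_deriv hy).congr_deriv ?_
  rw [act_add_right, hu.qinv.act_rot_eq (cross ω (y t)), quatRate]
  generalize act (rot (qinv (Q t))) y' = z
  apply ext_coord <;>
  · simp only [qinv, act_S, norm_sq_coord, inner_coord, PiLp.add_apply, PiLp.sub_apply,
      PiLp.neg_apply, PiLp.smul_apply, smul_eq_mul, cross_apply_zero, cross_apply_one,
      cross_apply_two]
    ring

lemma hasDerivWithinAt_quat_norm_sq (hQ : HasDerivWithinAt Q (quatRate (Q t) ω) J t) :
    HasDerivWithinAt (fun s => (Q s).1 ^ 2 + ‖(Q s).2‖ ^ 2) 0 J t := by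
  refine (((hasDerivWithinAt_quat_fst hQ).pow 2).add
    (hasDerivWithinAt_quat_snd hQ).norm_sq).congr_deriv ?_
  rw [quatRate, act_S, inner_smul_right, inner_add_right, inner_smul_right, inner_left_cross]
  push_cast
  ring

lemma IsUnitQuat.act_rot_qmul_qinv_snd {D : ℝ × E3} (hD : IsUnitQuat D) (Q : ℝ × E3) :
    act (rot D) (VTOL.qmul Q (VTOL.qinv D)).2 = (VTOL.qmul (VTOL.qinv D) Q).2 := by
  have homogeneous : (VTOL.qmul (VTOL.qinv D) Q).2
      = (D.1 ^ 2 + ‖D.2‖ ^ 2) • (VTOL.qmul (VTOL.qinv D) Q).2 := by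
    rw [show D.1 ^ 2 + ‖D.2‖ ^ 2 = 1 from hD, one_smul]
  rw [homogeneous, hD.act_rot_eq, VTOL.qmul, VTOL.qmul, VTOL.qinv]
  apply ext_coord <;>
  · simp only [act_S, norm_sq_coord, inner_coord, PiLp.add_apply, PiLp.sub_apply, PiLp.neg_apply,
      PiLp.smul_apply, smul_eq_mul, cross_apply_zero, cross_apply_one, cross_apply_two]
    ring

lemma hasDerivWithinAt_qmul_qinv_fst (hQ : HasDerivWithinAt Q (quatRate (Q t) ω) J t)
    (hQd : HasDerivWithinAt Qd (quatRate (Qd t) ωd) J t) (hu : IsUnitQuat (Qd t)) :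
    HasDerivWithinAt (fun s => (qmul (Q s) (qinv (Qd s))).1)
      (-(1 / 2) * inner ℝ (qmul (Q t) (qinv (Qd t))).2
        (act (rot (Qd t)).transpose (ω - ωd))) J t := by
  refine (((hasDerivWithinAt_quat_fst hQ).mul (hasDerivWithinAt_quat_fst hQd)).sub
    ((hasDerivWithinAt_quat_snd hQ).inner ℝ
      (hasDerivWithinAt_quat_snd hQd).neg)).congr_deriv ?_
  rw [real_inner_comm (act _ _), inner_act_transpose, real_inner_comm, hu.act_rot_qmul_qinv_snd]
  simp only [quatRate, qmul, qinv, act_S, inner_coord, Pi.neg_apply, PiLp.add_apply,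
    PiLp.sub_apply, PiLp.neg_apply, PiLp.smul_apply, smul_eq_mul, cross_apply_zero,
    cross_apply_one, cross_apply_two]
  ring

end Kinematics

lemma inner_cross_act_rot (Q : ℝ × E3) (r : E3) :
    inner ℝ Q.2 (cross r (act (rot Q) r)) = -(2 * Q.1) * ‖cross Q.2 r‖ ^ 2 := by
  rw [act_rot]
  simp only [norm_sq_coord, inner_coord, PiLp.add_apply, PiLp.sub_apply,
    PiLp.smul_apply, smul_eq_mul, cross_apply_zero, cross_apply_one, cross_apply_two]
  ring

/-! ### The closed loop -/

/-- The translational gains are positive and leave a thrust margin, so that the desired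
acceleration `μ_d` never reaches the singularity of the attitude extraction. -/
structure ThrustMargin (P : Vehicle) (K : Gains) : Prop where
  kp_pos : 0 < K.kp
  kv_pos : 0 < K.kv
  lt_g : K.kp + K.kv < P.g

/-- The rate `dμ_d/dt` along solutions. -/
def muRate (P : Vehicle) (K : Gains) (X : State) : E3 :=
  -(K.kp • act (phi (eP P X)) X.v) - K.kv • act (phi X.v) (P.g • e3 + r2 P K X)

/-- The error, in the angular velocity of the attitude error, caused by replacing `r₂` with
`R_dᵀ b₂ = R̃ r₂` in the feedforward term of the control. -/
def feedforwardErr (P : Vehicle) (K : Gains) (X : State) : E3 :=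
  act (RD P K X).transpose (act (M P.g (muD P K X))
    (K.kv • act (phi X.v) (r2 P K X - act (rot (Qerr P K X)) (r2 P K X))))

section ClosedLoopIdentities

variable {P : Vehicle} {K : Gains} {X : State}

lemma ThrustMargin.norm_muD_le (hK : ThrustMargin P K) (X : State) :
    ‖muD P K X‖ ≤ K.kp + K.kv := by
  have kp_pos := hK.kp_pos
  have kv_pos := hK.kv_pos
  calc ‖muD P K X‖ ≤ K.kp * ‖h (eP P X)‖ + K.kv * ‖h X.v‖ := by
        refine (norm_sub_le _ _).trans_eq ?_
        rw [norm_neg, norm_smul, norm_smul, Real.norm_of_nonneg kp_pos.le,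
          Real.norm_of_nonneg kv_pos.le]
    _ ≤ K.kp * 1 + K.kv * 1 := by gcongr <;> exact norm_h_le_one _
    _ = K.kp + K.kv := by ring

lemma ThrustMargin.norm_muD_lt (hK : ThrustMargin P K) (X : State) : ‖muD P K X‖ < P.g :=
  (hK.norm_muD_le X).trans_lt hK.lt_g

lemma ThrustMargin.g_pos (hK : ThrustMargin P K) : 0 < P.g :=
  (add_pos hK.kp_pos hK.kv_pos).trans hK.lt_g

lemma ThrustMargin.le_uT (hK : ThrustMargin P K) (X : State) : P.g - K.kp - K.kv ≤ uT P K X := by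
  rw [uT]
  linarith [le_thrust hK.g_pos.le (muD P K X), hK.norm_muD_le X]

lemma ThrustMargin.uT_le (hK : ThrustMargin P K) (X : State) : uT P K X ≤ P.g + K.kp + K.kv := by
  rw [uT]
  linarith [thrust_le hK.g_pos.le (muD P K X), hK.norm_muD_le X]

lemma ThrustMargin.isUnitQuat_QD (hK : ThrustMargin P K) (X : State) : IsUnitQuat (QD P K X) :=
  isUnitQuat_attD (hK.norm_muD_lt X)

lemma ThrustMargin.isUnitQuat_Qerr (hK : ThrustMargin P K) (hQ : IsUnitQuat X.Q) :
    IsUnitQuat (Qerr P K X) :=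
  hQ.qmul (hK.isUnitQuat_QD X).qinv

lemma ThrustMargin.act_rot_Qerr (hK : ThrustMargin P K) (hQ : IsUnitQuat X.Q) (y : E3) :
    act (rot (Qerr P K X)) y = act (RD P K X).transpose (act (rot X.Q) y) := by
  rw [Qerr, hQ.act_rot_qmul (hK.isUnitQuat_QD X).qinv, RD, rot_transpose]

lemma ThrustMargin.act_RD_transpose_cross (hK : ThrustMargin P K) (X : State) (y z : E3) :
    act (RD P K X).transpose (cross y z)
      = cross (act (RD P K X).transpose y) (act (RD P K X).transpose z) := by
  rw [RD, rot_transpose, (hK.isUnitQuat_QD X).qinv.rot_cross]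

lemma ThrustMargin.act_RD_transpose_RD (hK : ThrustMargin P K) (X : State) (y : E3) :
    act (RD P K X).transpose (act (RD P K X) y) = y :=
  (hK.isUnitQuat_QD X).act_rot_transpose_rot y

lemma ThrustMargin.uT_smul_RD_transpose_e3 (hK : ThrustMargin P K) (X : State) :
    uT P K X • act (RD P K X).transpose e3 = P.g • e3 - muD P K X :=
  thrust_smul_rot_attD_transpose_e3 (hK.norm_muD_lt X)

lemma ThrustMargin.act_RD_transpose_psi (hK : ThrustMargin P K) (hQ : IsUnitQuat X.Q) :
    act (RD P K X).transpose (psi P K X)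
      = K.γ₁ • cross P.r₁ (act (rot (Qerr P K X)) P.r₁)
        + K.γ₂ • cross (r2 P K X) (act (rot (Qerr P K X)) (r2 P K X))
        + K.γ₂ • cross (r2err P K X) (act (rot (Qerr P K X)) (r2 P K X)) := by
  have observed (y : E3) : K.k₁ • cross (X.v - X.vhat) y
      = cross (r2err P K X + (r2 P K X - act (rot (Qerr P K X)) (r2 P K X))) y := by
    rw [r2err, act_sub, act_one, sub_add_cancel, map_smul, smul_apply]
  rw [psi, act_S, act_S, act_add_right, act_smul_right, act_smul_right, hK.act_RD_transpose_cross,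
    hK.act_RD_transpose_cross, hK.act_RD_transpose_RD, hK.act_RD_transpose_RD, b1, b2,
    ← hK.act_rot_Qerr hQ, ← hK.act_rot_Qerr hQ, mul_smul, observed, map_add, map_sub, add_apply,
    sub_apply, cross_self, sub_zero]
  module

lemma ThrustMargin.omega_eq (hK : ThrustMargin P K) (hQ : IsUnitQuat X.Q) :
    omega P K X = act (M P.g (muD P K X)) (muRate P K X
      + K.kv • act (phi X.v) (r2 P K X - act (rot (Qerr P K X)) (r2 P K X))) + psi P K X := by
  have sat_eq : K.kp • h (eP P X) + K.kv • h X.v = -muD P K X := by rw [muD]; abel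
  rw [omega, act_add_right (RD P K X).transpose, act_smul_right (RD P K X).transpose,
    hK.uT_smul_RD_transpose_e3, b2, ← hK.act_rot_Qerr hQ, fMuD, muRate, sat_eq]
  simp only [act_add_right (phi X.v), act_sub_right (phi X.v), act_neg_right]
  congr 2
  module

lemma ThrustMargin.act_RD_transpose_omega_sub (hK : ThrustMargin P K) (hQ : IsUnitQuat X.Q) :
    act (RD P K X).transpose (omega P K X - act (M P.g (muD P K X)) (muRate P K X))
      = feedforwardErr P K X + act (RD P K X).transpose (psi P K X) := by
  rw [hK.omega_eq hQ, feedforwardErr, act_add_right (M P.g (muD P K X)), add_assoc,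
    add_sub_cancel_left, act_add_right]

lemma acceleration_eq (P : Vehicle) (K : Gains) (X : State) :
    P.g • e3 - uT P K X • act (rot X.Q).transpose e3 + P.δ X.v = P.g • e3 + r2 P K X := by
  rw [r2]; abel

lemma ThrustMargin.acceleration_eq_muD_add (hK : ThrustMargin P K) (hQ : IsUnitQuat X.Q) :
    P.g • e3 + r2 P K X = muD P K X + P.δ X.v
      - uT P K X • (act (rot X.Q).transpose e3
        - act (rot (Qerr P K X)) (act (rot X.Q).transpose e3)) := by
  rw [hK.act_rot_Qerr hQ, hQ.act_rot_rot_transpose, smul_sub, hK.uT_smul_RD_transpose_e3, r2]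
  abel

lemma ThrustMargin.filter_rate (hK : ThrustMargin P K) (hQ : IsUnitQuat X.Q) (hk₁ : K.k₁ ≠ 0) :
    K.k₁ • (P.g • e3 + r2 P K X - vhatRate P K X)
      = -(K.k₁ • r2err P K X)
        - cross (act (rot (Qerr P K X)) (r2 P K X)) (act (RD P K X).transpose (psi P K X)) := by
  rw [vhatRate, act_S, hK.act_RD_transpose_cross, b2, ← hK.act_rot_Qerr hQ, r2err, act_sub,
    act_one]
  match_scalars <;> field_simp; ring

end ClosedLoopIdentities

/-! ### Rates along solutions -/

/-- The mechanical energy of the translational subsystem under the virtual control law, with the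
potential `k_p (√(1 + ‖e_p‖²) - 1)` of the proportional term. -/
def energy (P : Vehicle) (kp : ℝ) (X : State) : ℝ :=
  kp * (√(1 + ‖eP P X‖ ^ 2) - 1) + 1 / 2 * ‖X.v‖ ^ 2

section Rates

variable {P : Vehicle} {K : Gains} {J : Set ℝ} {x : ℝ → State} {t : ℝ}

lemma IsSolution.hasDerivWithinAt_v (hx : IsSolution P K J x) (ht : t ∈ J) :
    HasDerivWithinAt (fun s => (x s).v) (P.g • e3 + r2 P K (x t)) J t := by
  rw [← acceleration_eq]
  exact hx.velocity t ht

lemma IsSolution.hasDerivWithinAt_eP (hx : IsSolution P K J x) (ht : t ∈ J) :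
    HasDerivWithinAt (fun s => eP P (x s)) (x t).v J t :=
  (hx.position t ht).sub_const P.pr

lemma IsSolution.hasDerivWithinAt_muD (hx : IsSolution P K J x) (ht : t ∈ J) :
    HasDerivWithinAt (fun s => muD P K (x s)) (muRate P K (x t)) J t :=
  ((hasDerivWithinAt_h (hx.hasDerivWithinAt_eP ht)).const_smul K.kp).neg.sub
    ((hasDerivWithinAt_h (hx.hasDerivWithinAt_v ht)).const_smul K.kv)

lemma IsSolution.hasDerivWithinAt_QD (hx : IsSolution P K J x) (hK : ThrustMargin P K)
    (ht : t ∈ J) :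
    HasDerivWithinAt (fun s => QD P K (x s))
      (quatRate (QD P K (x t)) (act (M P.g (muD P K (x t))) (muRate P K (x t)))) J t :=
  hasDerivWithinAt_attD (hx.hasDerivWithinAt_muD ht) fun s => hK.norm_muD_lt (x s)

lemma IsSolution.hasDerivWithinAt_Qerr_fst (hx : IsSolution P K J x) (hK : ThrustMargin P K)
    (ht : t ∈ J) (hQ : IsUnitQuat (x t).Q) :
    HasDerivWithinAt (fun s => (Qerr P K (x s)).1)
      (-(1 / 2) * inner ℝ (Qerr P K (x t)).2
        (feedforwardErr P K (x t) + act (RD P K (x t)).transpose (psi P K (x t)))) J t := by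
  rw [← hK.act_RD_transpose_omega_sub hQ]
  exact hasDerivWithinAt_qmul_qinv_fst (hx.attitude t ht) (hx.hasDerivWithinAt_QD hK ht)
    (hK.isUnitQuat_QD (x t))

lemma IsSolution.exists_hasDerivWithinAt_r2 (hx : IsSolution P K J x) (hK : ThrustMargin P K)
    (ht : t ∈ J) (hQ : IsUnitQuat (x t).Q) {δ' : E3}
    (hδ : HasDerivWithinAt (fun s => P.δ (x s).v) δ' J t) :
    ∃ r' : E3, HasDerivWithinAt (fun s => r2 P K (x s)) r' J t ∧
      ‖r'‖ ≤ ‖muRate P K (x t)‖ + uT P K (x t) * ‖omega P K (x t)‖ + ‖δ'‖ := by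
  have uT_deriv := hasDerivWithinAt_thrust (hx.hasDerivWithinAt_muD ht) (hK.norm_muD_lt (x t))
  have dir_deriv := hasDerivWithinAt_act_rot_transpose_of_quatRate (hx.attitude t ht)
    (hasDerivWithinAt_const t J e3) hQ
  refine ⟨_, (uT_deriv.smul dir_deriv).neg.add hδ, ?_⟩
  have thrustRate_le : ‖-inner ℝ (thrustDir P.g (muD P K (x t))) (muRate P K (x t))‖
      ≤ ‖muRate P K (x t)‖ := by
    rw [norm_neg]
    simpa [norm_thrustDir (hK.norm_muD_lt (x t))] using
      norm_inner_le_norm (𝕜 := ℝ) (thrustDir P.g (muD P K (x t))) (muRate P K (x t))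
  have cross_le : ‖cross (omega P K (x t)) e3‖ ≤ ‖omega P K (x t)‖ := by
    simpa [norm_e3] using norm_cross_le (omega P K (x t)) e3
  refine norm_add_le_of_le ?_ le_rfl
  rw [norm_neg, add_comm (‖muRate P K (x t)‖)]
  refine norm_add_le_of_le ?_ ?_
  · rw [norm_smul, hQ.norm_rot_transpose, zero_add, uT, thrust, norm_norm]
    gcongr
  · rwa [norm_smul, hQ.norm_rot_transpose, norm_e3, mul_one]

lemma IsSolution.hasDerivWithinAt_act_rot_Qerr_r2 (hx : IsSolution P K J x)
    (hK : ThrustMargin P K) (hQ : ∀ s ∈ J, IsUnitQuat (x s).Q) (ht : t ∈ J) {r' : E3}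
    (hr : HasDerivWithinAt (fun s => r2 P K (x s)) r' J t) :
    HasDerivWithinAt (fun s => act (rot (Qerr P K (x s))) (r2 P K (x s)))
      (act (rot (Qerr P K (x t))) r' + cross (act (rot (Qerr P K (x t))) (r2 P K (x t)))
          (feedforwardErr P K (x t) + act (RD P K (x t)).transpose (psi P K (x t)))) J t := by
  have b2_deriv := hasDerivWithinAt_act_rot_of_quatRate (hx.attitude t ht) hr (hQ t ht)
  have deriv : HasDerivWithinAt
      (fun s => act (RD P K (x s)).transpose (act (rot (x s).Q) (r2 P K (x s)))) _ J t :=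
    hasDerivWithinAt_act_rot_transpose_of_quatRate (hx.hasDerivWithinAt_QD hK ht) b2_deriv
      (hK.isUnitQuat_QD (x t))
  refine (deriv.congr_of_mem (fun s hs => hK.act_rot_Qerr (hQ s hs) _) ht).congr_deriv ?_
  rw [← hK.act_RD_transpose_omega_sub (hQ t ht), hK.act_rot_Qerr (hQ t ht),
    hK.act_rot_Qerr (hQ t ht), ← hK.act_RD_transpose_cross, ← act_add_right, sub_add, ← sub_apply,
    ← map_sub, cross_anticomm _ (act (rot (x t).Q) (r2 P K (x t))), sub_neg_eq_add]
  rfl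

lemma IsSolution.hasDerivWithinAt_r2err (hx : IsSolution P K J x) (hK : ThrustMargin P K)
    (hQ : ∀ s ∈ J, IsUnitQuat (x s).Q) (hk₁ : K.k₁ ≠ 0) (ht : t ∈ J) {r' : E3}
    (hr : HasDerivWithinAt (fun s => r2 P K (x s)) r' J t) :
    HasDerivWithinAt (fun s => r2err P K (x s))
      (-(K.k₁ • r2err P K (x t))
        + cross (act (rot (Qerr P K (x t))) (r2 P K (x t))) (feedforwardErr P K (x t))
        - (r' - act (rot (Qerr P K (x t))) r')) J t := by
  have deriv := (((hx.hasDerivWithinAt_v ht).sub (hx.filter t ht)).const_smul K.k₁).sub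
    (hr.sub (hx.hasDerivWithinAt_act_rot_Qerr_r2 hK hQ ht hr))
  simp only [r2err, act_sub, act_one]
  refine deriv.congr_deriv ?_
  rw [hK.filter_rate (hQ t ht) hk₁, map_add, r2err, act_sub, act_one]
  abel

lemma IsSolution.hasDerivWithinAt_energy (hx : IsSolution P K J x) (ht : t ∈ J) :
    HasDerivWithinAt (fun s => energy P K.kp (x s))
      (K.kp * inner ℝ (h (eP P (x t))) (x t).v
        + inner ℝ (x t).v (P.g • e3 + r2 P K (x t))) J t := by
  have potential_deriv := ((hasDerivWithinAt_sqrt_one_add_norm_sq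
    (hx.hasDerivWithinAt_eP ht)).sub_const 1).const_mul K.kp
  have kinetic_deriv := (hx.hasDerivWithinAt_v ht).norm_sq.const_mul (1 / 2)
  refine (potential_deriv.add kinetic_deriv).congr_deriv ?_
  ring

end Rates

/-! ### Pointwise bounds -/

lemma IsUnitQuat.norm_cross_act_rot_le {Q : ℝ × E3} (hQ : IsUnitQuat Q) (x y : E3) :
    ‖cross x (act (rot Q) y)‖ ≤ ‖x‖ * ‖y‖ := by
  simpa [hQ.norm_rot] using norm_cross_le x (act (rot Q) y)

section Bounds

variable {P : Vehicle} {K : Gains} {X : State}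

lemma uT_nonneg (P : Vehicle) (K : Gains) (X : State) : 0 ≤ uT P K X := norm_nonneg _

lemma norm_r2_le (hQ : IsUnitQuat X.Q) : ‖r2 P K X‖ ≤ uT P K X + ‖P.δ X.v‖ := by
  rw [r2]
  refine norm_add_le_of_le ?_ le_rfl
  rw [norm_neg, norm_smul, hQ.norm_rot_transpose, norm_e3, mul_one,
    Real.norm_of_nonneg (uT_nonneg P K X)]

lemma ThrustMargin.norm_muRate_le (hK : ThrustMargin P K) (X : State) :
    ‖muRate P K X‖ ≤ K.kp * ‖X.v‖ + K.kv * (P.g + ‖r2 P K X‖) := by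
  have kp_pos := hK.kp_pos
  have kv_pos := hK.kv_pos
  have acceleration_le : ‖P.g • e3 + r2 P K X‖ ≤ P.g + ‖r2 P K X‖ := by
    simpa [norm_smul, norm_e3, abs_of_pos hK.g_pos] using norm_add_le (P.g • e3) (r2 P K X)
  rw [muRate]
  refine norm_sub_le_of_le ?_ ?_
  · rw [norm_neg, norm_smul, Real.norm_of_nonneg kp_pos.le]
    gcongr
    exact norm_phi_le _ _
  · rw [norm_smul, Real.norm_of_nonneg kv_pos.le]
    gcongr
    exact (norm_phi_le _ _).trans acceleration_le

lemma ThrustMargin.norm_act_M_le (hK : ThrustMargin P K) (X : State) (y : E3) :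
    ‖act (M P.g (muD P K X)) y‖ ≤ 4 / (P.g - K.kp - K.kv) * ‖y‖ := by
  rw [sub_sub]
  exact norm_M_le (hK.norm_muD_le X) hK.lt_g y

lemma ThrustMargin.norm_smul_act_phi_sub_le (hK : ThrustMargin P K) (hQ : IsUnitQuat X.Q) :
    ‖K.kv • act (phi X.v) (r2 P K X - act (rot (Qerr P K X)) (r2 P K X))‖
      ≤ K.kv * (2 * ‖(Qerr P K X).2‖ * ‖r2 P K X‖) := by
  have kv_pos := hK.kv_pos
  rw [norm_smul, Real.norm_of_nonneg kv_pos.le]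
  gcongr
  exact (norm_phi_le _ _).trans ((hK.isUnitQuat_Qerr hQ).norm_sub_rot_le _)

lemma ThrustMargin.norm_feedforwardErr_le (hK : ThrustMargin P K) (hQ : IsUnitQuat X.Q) :
    ‖feedforwardErr P K X‖
      ≤ 4 / (P.g - K.kp - K.kv) * (K.kv * (2 * ‖(Qerr P K X).2‖ * ‖r2 P K X‖)) := by
  have margin_pos : 0 < P.g - K.kp - K.kv := by linarith [hK.lt_g]
  rw [feedforwardErr, RD, (hK.isUnitQuat_QD X).norm_rot_transpose]
  refine (hK.norm_act_M_le X _).trans ?_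
  gcongr
  exact hK.norm_smul_act_phi_sub_le hQ

lemma ThrustMargin.norm_psi_le (hK : ThrustMargin P K) (hQ : IsUnitQuat X.Q) (hγ₁ : 0 ≤ K.γ₁)
    (hγ₂ : 0 ≤ K.γ₂) :
    ‖psi P K X‖ ≤ K.γ₁ * (‖P.r₁‖ * ‖P.r₁‖) + K.γ₂ * (‖r2 P K X‖ * ‖r2 P K X‖)
      + K.γ₂ * (‖r2err P K X‖ * ‖r2 P K X‖) := by
  have hQe := hK.isUnitQuat_Qerr hQ
  rw [← (hK.isUnitQuat_QD X).norm_rot_transpose, ← RD, hK.act_RD_transpose_psi hQ]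
  refine norm_add₃_le.trans ?_
  rw [norm_smul, norm_smul, norm_smul, Real.norm_of_nonneg hγ₁, Real.norm_of_nonneg hγ₂]
  gcongr <;> exact hQe.norm_cross_act_rot_le _ _

lemma ThrustMargin.norm_omega_le (hK : ThrustMargin P K) (hQ : IsUnitQuat X.Q) :
    ‖omega P K X‖ ≤ 4 / (P.g - K.kp - K.kv) * (‖muRate P K X‖ + K.kv * (2 * ‖r2 P K X‖))
      + ‖psi P K X‖ := by
  have margin_pos : 0 < P.g - K.kp - K.kv := by linarith [hK.lt_g]
  have kv_pos := hK.kv_pos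
  rw [hK.omega_eq hQ]
  refine norm_add_le_of_le ((hK.norm_act_M_le X _).trans ?_) le_rfl
  gcongr
  refine norm_add_le_of_le le_rfl ((hK.norm_smul_act_phi_sub_le hQ).trans ?_)
  gcongr
  linarith [(hK.isUnitQuat_Qerr hQ).norm_snd_le_one]

lemma ThrustMargin.norm_thrustErr_le (hK : ThrustMargin P K) (hQ : IsUnitQuat X.Q) :
    ‖uT P K X • (act (rot X.Q).transpose e3
        - act (rot (Qerr P K X)) (act (rot X.Q).transpose e3))‖
      ≤ (P.g + K.kp + K.kv) * (2 * ‖(Qerr P K X).2‖) := by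
  have chord := (hK.isUnitQuat_Qerr hQ).norm_sub_rot_le (act (rot X.Q).transpose e3)
  rw [hQ.norm_rot_transpose, norm_e3, mul_one] at chord
  have uT_nonneg := uT_nonneg P K X
  have uT_le := hK.uT_le X
  rw [norm_smul, Real.norm_of_nonneg uT_nonneg]
  gcongr
  linarith

lemma ThrustMargin.energyRate_le (hK : ThrustMargin P K) (hQ : IsUnitQuat X.Q)
    (hδ : inner ℝ (P.δ X.v) X.v ≤ 0) :
    K.kp * inner ℝ (h (eP P X)) X.v + inner ℝ X.v (P.g • e3 + r2 P K X)
      ≤ -(K.kv * (‖X.v‖ ^ 2 / √(1 + ‖X.v‖ ^ 2)))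
        + (P.g + K.kp + K.kv) * (2 * ‖(Qerr P K X).2‖) * ‖X.v‖ := by
  set thrustErr := uT P K X • (act (rot X.Q).transpose e3
    - act (rot (Qerr P K X)) (act (rot X.Q).transpose e3)) with thrustErr_def
  have power_le : -inner ℝ X.v thrustErr
      ≤ (P.g + K.kp + K.kv) * (2 * ‖(Qerr P K X).2‖) * ‖X.v‖ := by
    rw [← inner_neg_right, mul_comm _ ‖X.v‖]
    refine (real_inner_le_norm _ _).trans ?_
    rw [norm_neg]
    gcongr
    exact hK.norm_thrustErr_le hQ
  rw [hK.acceleration_eq_muD_add hQ, ← thrustErr_def, muD, inner_sub_right, inner_add_right,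
    inner_sub_right, inner_neg_right, inner_smul_right, inner_smul_right, inner_self_h,
    real_inner_comm X.v (h (eP P X)), real_inner_comm (P.δ X.v)]
  linarith

lemma ThrustMargin.attErrRate_le (hK : ThrustMargin P K) (hQ : IsUnitQuat X.Q) {w γ : ℝ}
    (hγ : 0 ≤ γ) (hγ₁ : γ ≤ K.γ₁) (hγ₂ : γ ≤ K.γ₂)
    (hw : ∀ y : E3, w * ‖y‖ ^ 2 ≤ ‖cross y P.r₁‖ ^ 2 + ‖cross y (r2 P K X)‖ ^ 2) :
    (Qerr P K X).1 * inner ℝ (Qerr P K X).2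
        (feedforwardErr P K X + act (RD P K X).transpose (psi P K X))
      ≤ -(2 * (Qerr P K X).1 ^ 2 * (γ * (w * ‖(Qerr P K X).2‖ ^ 2)))
        + K.γ₂ * (‖(Qerr P K X).2‖ * (‖r2err P K X‖ * ‖r2 P K X‖))
        + ‖(Qerr P K X).2‖ * ‖feedforwardErr P K X‖ := by
  have hQe := hK.isUnitQuat_Qerr hQ
  set q := Qerr P K X
  have γ₂_nonneg := hγ.trans hγ₂
  have fst_mul_inner_le (y : E3) : q.1 * inner ℝ q.2 y ≤ ‖q.2‖ * ‖y‖ := by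
    refine (le_abs_self _).trans ?_
    rw [abs_mul]
    simpa using mul_le_mul hQe.abs_fst_le_one (abs_real_inner_le_norm q.2 y) (abs_nonneg _)
      zero_le_one
  have filter_le : q.1 * inner ℝ q.2 (cross (r2err P K X) (act (rot q) (r2 P K X)))
      ≤ ‖q.2‖ * (‖r2err P K X‖ * ‖r2 P K X‖) := by
    refine (fst_mul_inner_le _).trans ?_
    gcongr
    exact hQe.norm_cross_act_rot_le _ _
  have excitation : γ * (w * ‖q.2‖ ^ 2)
      ≤ K.γ₁ * ‖cross q.2 P.r₁‖ ^ 2 + K.γ₂ * ‖cross q.2 (r2 P K X)‖ ^ 2 := by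
    calc _ ≤ γ * ‖cross q.2 P.r₁‖ ^ 2 + γ * ‖cross q.2 (r2 P K X)‖ ^ 2 := by
          rw [← mul_add]; gcongr; exact hw q.2
      _ ≤ _ := by gcongr
  rw [hK.act_RD_transpose_psi hQ, inner_add_right, inner_add_right, inner_add_right,
    inner_smul_right, inner_smul_right, inner_smul_right, inner_cross_act_rot,
    inner_cross_act_rot]
  linarith [fst_mul_inner_le (feedforwardErr P K X),
    mul_le_mul_of_nonneg_left filter_le γ₂_nonneg,
    mul_le_mul_of_nonneg_left excitation (by positivity : 0 ≤ 2 * q.1 ^ 2)]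

lemma ThrustMargin.filterErrRate_le (hK : ThrustMargin P K) (hQ : IsUnitQuat X.Q) (r' : E3) :
    inner ℝ (r2err P K X) (-(K.k₁ • r2err P K X)
        + cross (act (rot (Qerr P K X)) (r2 P K X)) (feedforwardErr P K X)
        - (r' - act (rot (Qerr P K X)) r'))
      ≤ -(K.k₁ * ‖r2err P K X‖ ^ 2) + ‖r2err P K X‖ *
        (‖r2 P K X‖ * ‖feedforwardErr P K X‖ + 2 * ‖(Qerr P K X).2‖ * ‖r'‖) := by
  have hQe := hK.isUnitQuat_Qerr hQ
  rw [add_sub_assoc, inner_add_right, inner_neg_right, inner_smul_right,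
    real_inner_self_eq_norm_sq]
  gcongr
  refine (real_inner_le_norm _ _).trans ?_
  gcongr
  refine norm_sub_le_of_le ?_ (hQe.norm_sub_rot_le _)
  rw [cross_anticomm, norm_neg, mul_comm]
  exact hQe.norm_cross_act_rot_le _ _

end Bounds

/-! ### The smallest eigenvalue -/

lemma isHermitian_W (a b : ℝ) (r₁ r₂ : E3) : (W a b r₁ r₂).IsHermitian := by
  rw [Matrix.IsHermitian, Matrix.conjTranspose_eq_transpose_of_trivial]
  simp [W, Matrix.transpose_pow, S_transpose]

lemma lambdaMin_mul_norm_sq_le {A : Mat3} (hA : A.IsHermitian) (y : E3) :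
    lambdaMin A * ‖y‖ ^ 2 ≤ inner ℝ y (act A y) := by
  have shifted_posSemidef : (A - algebraMap ℝ Mat3 (lambdaMin A)).PosSemidef := by
    rw [Matrix.posSemidef_iff_isHermitian_and_spectrum_nonneg]
    refine ⟨hA.sub (by simp [Algebra.algebraMap_eq_smul_one, Matrix.IsHermitian]), ?_⟩
    rw [← spectrum.sub_singleton_eq]
    rintro _ ⟨z, hz, _, rfl, rfl⟩
    exact sub_nonneg.2 (csInf_le A.finite_real_spectrum.bddBelow hz)
  have quadForm_eq : inner ℝ y (act (A - algebraMap ℝ Mat3 (lambdaMin A)) y)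
      = inner ℝ y (act A y) - lambdaMin A * ‖y‖ ^ 2 := by
    rw [Algebra.algebraMap_eq_smul_one, act_sub, act_smul, act_one, inner_sub_right,
      inner_smul_right, real_inner_self_eq_norm_sq]
  have quadForm_nonneg : 0 ≤ inner ℝ y (act (A - algebraMap ℝ Mat3 (lambdaMin A)) y) := by
    rw [EuclideanSpace.inner_eq_star_dotProduct, dotProduct_comm]
    exact shifted_posSemidef.dotProduct_mulVec_nonneg y.ofLp
  linarith

lemma inner_act_W (a b : ℝ) (r₁ r₂ y : E3) :
    inner ℝ y (act (W a b r₁ r₂) y) = a * ‖cross y r₁‖ ^ 2 + b * ‖cross y r₂‖ ^ 2 := by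
  rw [W, act_sub, ← neg_smul, act_smul, act_smul, act_S_sq, act_S_sq, cross_cross, cross_cross,
    norm_cross_sq, norm_cross_sq, inner_sub_right, inner_smul_right, inner_smul_right,
    inner_sub_right, inner_sub_right, inner_smul_right, inner_smul_right, inner_smul_right,
    inner_smul_right]
  simp only [real_inner_self_eq_norm_sq, real_inner_comm y]
  ring

/-! ### Differential inequalities -/

lemma Icc_subset_timeInterval {t₀ t : ℝ} {T : EReal} (ht : t ∈ timeInterval t₀ T) :
    Set.Icc t₀ t ⊆ timeInterval t₀ T :=
  fun _ hs => ⟨hs.1, (EReal.coe_le_coe_iff.2 hs.2).trans_lt ht.2⟩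

lemma timeInterval_top (t₀ : ℝ) : timeInterval t₀ ⊤ = Set.Ici t₀ := by
  ext t
  simp [timeInterval, EReal.coe_lt_top]

lemma le_initial_of_deriv_nonpos {f f' : ℝ → ℝ} {J : Set ℝ} {a b : ℝ} (hab : a ≤ b)
    (hJ : Set.Icc a b ⊆ J) (hf : ∀ t ∈ J, HasDerivWithinAt f (f' t) J t)
    (hf' : ∀ t ∈ Set.Ioo a b, f' t ≤ 0) : f b ≤ f a := by
  have antitone := antitoneOn_of_hasDerivWithinAt_nonpos (convex_Icc a b) (f := f) (f' := f')
    (fun t ht => ((hf t (hJ ht)).mono hJ).continuousWithinAt)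
    (fun t ht => (hf t (hJ (interior_subset ht))).mono (interior_subset.trans hJ))
    (fun t ht => hf' t (by rwa [interior_Icc] at ht))
  exact antitone (Set.left_mem_Icc.2 hab) (Set.right_mem_Icc.2 hab) hab

lemma mem_of_continuousOn_of_forall_Ico_imp {α : Type*} [TopologicalSpace α] {y : ℝ → α}
    {G : Set α} {a b : ℝ} (hG : IsOpen G) (hab : a ≤ b) (hy : ContinuousOn y (Set.Icc a b))
    (h : ∀ t ∈ Set.Icc a b, (∀ s ∈ Set.Ico a t, y s ∈ G) → y t ∈ G) : y b ∈ G := by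
  by_contra hb
  have exit_compact : IsCompact (Set.Icc a b ∩ y ⁻¹' Gᶜ) :=
    isCompact_Icc.of_isClosed_subset
      (hy.preimage_isClosed_of_isClosed isClosed_Icc hG.isClosed_compl) Set.inter_subset_left
  obtain ⟨t, ⟨ht, exit⟩, first⟩ := exit_compact.exists_isLeast ⟨b, Set.right_mem_Icc.2 hab, hb⟩
  refine exit (h t ht fun s hs => ?_)
  by_contra hsG
  exact hs.2.not_ge (first ⟨⟨hs.1, hs.2.le.trans ht.2⟩, hsG⟩)

lemma le_initial_of_bootstrap {f₁ f₂ f₁' f₂' : ℝ → ℝ} {t₀ : ℝ} {T : EReal} {b₁ b₂ : ℝ}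
    (h₁ : ∀ t ∈ timeInterval t₀ T, HasDerivWithinAt f₁ (f₁' t) (timeInterval t₀ T) t)
    (h₂ : ∀ t ∈ timeInterval t₀ T, HasDerivWithinAt f₂ (f₂' t) (timeInterval t₀ T) t)
    (hb₁ : f₁ t₀ < b₁) (hb₂ : f₂ t₀ < b₂)
    (h : ∀ t ∈ timeInterval t₀ T, f₁ t < b₁ → f₂ t < b₂ → f₁' t ≤ 0 ∧ f₂' t ≤ 0) :
    ∀ t ∈ timeInterval t₀ T, f₁ t ≤ f₁ t₀ ∧ f₂ t ≤ f₂ t₀ := by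
  have decay : ∀ t ∈ timeInterval t₀ T, (∀ s ∈ Set.Ico t₀ t, f₁ s < b₁ ∧ f₂ s < b₂) →
      f₁ t ≤ f₁ t₀ ∧ f₂ t ≤ f₂ t₀ := by
    intro t ht below
    have hJ := Icc_subset_timeInterval ht
    have rates_nonpos : ∀ s ∈ Set.Ioo t₀ t, f₁' s ≤ 0 ∧ f₂' s ≤ 0 := fun s hs =>
      have below_s := below s (Set.Ioo_subset_Ico_self hs)
      h s (hJ (Set.Ioo_subset_Icc_self hs)) below_s.1 below_s.2
    exact ⟨le_initial_of_deriv_nonpos ht.1 hJ h₁ fun s hs => (rates_nonpos s hs).1,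
      le_initial_of_deriv_nonpos ht.1 hJ h₂ fun s hs => (rates_nonpos s hs).2⟩
  have below : ∀ t ∈ timeInterval t₀ T, f₁ t < b₁ ∧ f₂ t < b₂ := by
    intro t ht
    have hJ := Icc_subset_timeInterval ht
    have continuous : ContinuousOn (fun s => (f₁ s, f₂ s)) (Set.Icc t₀ t) := fun s hs =>
      ((h₁ s (hJ hs)).mono hJ).continuousWithinAt.prodMk
        ((h₂ s (hJ hs)).mono hJ).continuousWithinAt
    refine mem_of_continuousOn_of_forall_Ico_imp (G := Set.Iio b₁ ×ˢ Set.Iio b₂)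
      (isOpen_Iio.prod isOpen_Iio) ht.1 continuous fun s hs below_s => ?_
    have decay_s := decay s (hJ hs) below_s
    exact ⟨decay_s.1.trans_lt hb₁, decay_s.2.trans_lt hb₂⟩
  exact fun t ht => decay t ht fun s hs =>
    below s (Icc_subset_timeInterval ht (Set.Ico_subset_Icc_self hs))

lemma le_exp_of_deriv_le {f f' : ℝ → ℝ} {t₀ β : ℝ}
    (hf : ∀ t ∈ Set.Ici t₀, HasDerivWithinAt f (f' t) (Set.Ici t₀) t)
    (hf' : ∀ t ∈ Set.Ici t₀, f' t ≤ -(β * f t)) {t : ℝ} (ht : t₀ ≤ t) :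
    f t ≤ f t₀ * Real.exp (-(β * (t - t₀))) := by
  have weighted_deriv : ∀ s ∈ Set.Ici t₀,
      HasDerivWithinAt (fun s => f s * Real.exp (β * (s - t₀)))
        ((f' s + β * f s) * Real.exp (β * (s - t₀))) (Set.Ici t₀) s := by
    intro s hs
    have exponent_deriv : HasDerivWithinAt (fun s => β * (s - t₀)) (β * 1) (Set.Ici t₀) s :=
      ((hasDerivWithinAt_id s _).sub_const t₀).const_mul β
    refine ((hf s hs).fun_mul exponent_deriv.exp).congr_deriv ?_
    ring
  have weighted_le := le_initial_of_deriv_nonpos ht (fun s hs => hs.1) weighted_deriv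
    fun s hs => mul_nonpos_of_nonpos_of_nonneg (by linarith [hf' s hs.1.le]) (Real.exp_pos _).le
  simp only [sub_self, mul_zero, Real.exp_zero, mul_one] at weighted_le
  rwa [Real.exp_neg, ← div_eq_mul_inv, le_div_iff₀ (Real.exp_pos _)]

lemma tendsto_zero_of_sq_le_exp {E : Type*} [SeminormedAddCommGroup E] {y : ℝ → E}
    {t₀ β C : ℝ} (hβ : 0 < β)
    (hy : ∀ t, t₀ ≤ t → ‖y t‖ ^ 2 ≤ C * Real.exp (-(β * (t - t₀)))) :
    Filter.Tendsto y Filter.atTop (nhds 0) := by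
  have exponent_tendsto : Filter.Tendsto (fun t => β * (t - t₀)) Filter.atTop Filter.atTop :=
    (Filter.tendsto_atTop_add_const_right _ (-t₀) Filter.tendsto_id).const_mul_atTop hβ
  have bound_tendsto :
      Filter.Tendsto (fun t => C * Real.exp (-(β * (t - t₀)))) Filter.atTop (nhds 0) := by
    simpa using (Real.tendsto_exp_neg_atTop_nhds_zero.comp exponent_tendsto).const_mul C
  have norm_sq_tendsto : Filter.Tendsto (fun t => ‖y t‖ ^ 2) Filter.atTop (nhds 0) :=
    squeeze_zero' (Filter.Eventually.of_forall fun t => sq_nonneg _)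
      ((Filter.eventually_ge_atTop t₀).mono hy) bound_tendsto
  rw [tendsto_zero_iff_norm_tendsto_zero]
  simpa only [Real.sqrt_sq (norm_nonneg _), Real.sqrt_zero] using norm_sq_tendsto.sqrt

lemma IsSolution.isUnitQuat {P : Vehicle} {K : Gains} {t₀ : ℝ} {T : EReal} {x : ℝ → State}
    (hx : IsSolution P K (timeInterval t₀ T) x) (h₀ : IsUnitQuat (x t₀).Q) :
    ∀ t ∈ timeInterval t₀ T, IsUnitQuat (x t).Q := by
  intro t ht
  have norm_deriv := fun s hs => hasDerivWithinAt_quat_norm_sq (hx.attitude s hs)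
  have hJ := Icc_subset_timeInterval ht
  have norm_le := le_initial_of_deriv_nonpos ht.1 hJ norm_deriv fun _ _ => le_rfl
  have le_norm := le_initial_of_deriv_nonpos ht.1 hJ (fun s hs => (norm_deriv s hs).fun_neg)
    fun _ _ => neg_zero.le
  exact (norm_le.antisymm (neg_le_neg_iff.1 le_norm)).trans h₀

/-! ### The Lyapunov function of the attitude and filter errors -/

/-- The Lyapunov function `‖q̃‖² + a ‖r̃₂‖²` of the attitude and filter errors. It is written with
`‖q̃‖² = 1 - η̃²`, because the rate of `η̃` alone is at hand. -/
def attLyapunov (a : ℝ) (P : Vehicle) (K : Gains) (X : State) : ℝ :=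
  1 - (Qerr P K X).1 ^ 2 + a * ‖r2err P K X‖ ^ 2

/-- The rate of `attLyapunov` along solutions, when `r₂` has the rate `r'`. -/
def attLyapunovRate (a : ℝ) (P : Vehicle) (K : Gains) (X : State) (r' : E3) : ℝ :=
  (Qerr P K X).1 * inner ℝ (Qerr P K X).2
      (feedforwardErr P K X + act (RD P K X).transpose (psi P K X))
    + a * (2 * inner ℝ (r2err P K X) (-(K.k₁ • r2err P K X)
      + cross (act (rot (Qerr P K X)) (r2 P K X)) (feedforwardErr P K X)
      - (r' - act (rot (Qerr P K X)) r')))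

lemma IsSolution.hasDerivWithinAt_attLyapunov {P : Vehicle} {K : Gains} {J : Set ℝ}
    {x : ℝ → State} {t : ℝ} (hx : IsSolution P K J x) (hK : ThrustMargin P K)
    (hQ : ∀ s ∈ J, IsUnitQuat (x s).Q) (hk₁ : K.k₁ ≠ 0) (ht : t ∈ J) {r' : E3}
    (hr : HasDerivWithinAt (fun s => r2 P K (x s)) r' J t) (a : ℝ) :
    HasDerivWithinAt (fun s => attLyapunov a P K (x s)) (attLyapunovRate a P K (x t) r') J t := by
  have fst_deriv := hx.hasDerivWithinAt_Qerr_fst hK ht (hQ t ht)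
  have filter_deriv := hx.hasDerivWithinAt_r2err hK hQ hk₁ ht hr
  refine (((fst_deriv.fun_pow 2).const_sub 1).fun_add
    (filter_deriv.norm_sq.const_mul a)).congr_deriv ?_
  rw [attLyapunovRate]
  push_cast
  ring

section

variable {P : Vehicle} {K : Gains} {X : State} {a : ℝ}

lemma ThrustMargin.attLyapunov_eq (hK : ThrustMargin P K) (hQ : IsUnitQuat X.Q) (a : ℝ) :
    attLyapunov a P K X = ‖(Qerr P K X).2‖ ^ 2 + a * ‖r2err P K X‖ ^ 2 := by
  have unit : (Qerr P K X).1 ^ 2 + ‖(Qerr P K X).2‖ ^ 2 = 1 := hK.isUnitQuat_Qerr hQ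
  rw [attLyapunov]
  linarith

lemma ThrustMargin.norm_Qerr_snd_sq_le_attLyapunov (hK : ThrustMargin P K)
    (hQ : IsUnitQuat X.Q) (ha : 0 ≤ a) : ‖(Qerr P K X).2‖ ^ 2 ≤ attLyapunov a P K X := by
  rw [hK.attLyapunov_eq hQ]
  exact le_add_of_nonneg_right (by positivity)

lemma one_sub_Qerr_fst_sq_le_attLyapunov (ha : 0 ≤ a) :
    1 - (Qerr P K X).1 ^ 2 ≤ attLyapunov a P K X :=
  le_add_of_nonneg_right (by positivity)

/-- Completing the square in the coupling terms of the attitude error `q` and the filter error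
`z`: the gain `γ` dominates the `q²` terms, and then `k₁` dominates the `z²` terms. -/
lemma coupledRate_le {q z e w γ γ₂ k₁ F ρ A D Λ θ dq dz : ℝ}
    (hq : q ≤ 1) (ha : 0 ≤ a) (hD : 0 ≤ D) (hw : 0 ≤ w) (hγ : 0 ≤ γ) (he : θ ≤ e ^ 2)
    (hdq : dq ≤ -(2 * e ^ 2 * (γ * (w * q ^ 2))) + γ₂ * (q * (z * ρ)) + q * (2 * F * q))
    (hdz : dz ≤ -(k₁ * z ^ 2) + z * (ρ * (2 * F * q) + 2 * q * (A + D * z)))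
    (hΛγ : Λ + 1 + 2 * F ≤ 2 * θ * (γ * w))
    (hΛk : (γ₂ * ρ + 4 * a * (F * ρ + A)) ^ 2 / 4 + a * Λ ≤ 2 * a * (k₁ - 2 * D)) :
    dq + a * (2 * dz) ≤ -(Λ * (q ^ 2 + a * z ^ 2)) := by
  set G := γ₂ * ρ + 4 * a * (F * ρ + A) with G_def
  have attitude_damping : (Λ + 1 + 2 * F) * q ^ 2 ≤ 2 * e ^ 2 * (γ * (w * q ^ 2)) := by
    calc (Λ + 1 + 2 * F) * q ^ 2 ≤ 2 * θ * (γ * w) * q ^ 2 := by gcongr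
      _ ≤ 2 * e ^ 2 * (γ * w) * q ^ 2 := by gcongr
      _ = _ := by ring
  have filter_damping : (G ^ 2 / 4 + a * Λ) * z ^ 2 ≤ 2 * a * (k₁ - 2 * D) * z ^ 2 := by gcongr
  have filter_rate : a * dz
      ≤ a * (-(k₁ * z ^ 2) + 2 * (F * ρ + A) * (q * z) + 2 * D * z ^ 2) := by
    have : D * z ^ 2 * q ≤ D * z ^ 2 * 1 := by gcongr
    gcongr
    linarith
  have coupling : G * (q * z) ≤ q ^ 2 + G ^ 2 / 4 * z ^ 2 := by
    nlinarith [sq_nonneg (q - G * z / 2)]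
  rw [G_def] at coupling filter_damping
  linarith

lemma ThrustMargin.attLyapunovRate_le (hK : ThrustMargin P K) (hQ : IsUnitQuat X.Q)
    {w γ ρ A D Λ θ : ℝ} {r' : E3} (ha : 0 ≤ a) (hD : 0 ≤ D) (hw : 0 ≤ w) (hγ : 0 ≤ γ)
    (hγ₁ : γ ≤ K.γ₁) (hγ₂ : γ ≤ K.γ₂)
    (hW : ∀ y : E3, w * ‖y‖ ^ 2 ≤ ‖cross y P.r₁‖ ^ 2 + ‖cross y (r2 P K X)‖ ^ 2)
    (hρ : ‖r2 P K X‖ ≤ ρ) (hr' : ‖r'‖ ≤ A + D * ‖r2err P K X‖) (hθ : θ ≤ (Qerr P K X).1 ^ 2)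
    (hΛγ : Λ + 1 + 2 * (4 / (P.g - K.kp - K.kv) * (K.kv * ρ)) ≤ 2 * θ * (γ * w))
    (hΛk : (K.γ₂ * ρ + 4 * a * (4 / (P.g - K.kp - K.kv) * (K.kv * ρ) * ρ + A)) ^ 2 / 4 + a * Λ
      ≤ 2 * a * (K.k₁ - 2 * D)) :
    attLyapunovRate a P K X r' ≤ -(Λ * attLyapunov a P K X) := by
  have kv_pos := hK.kv_pos
  have margin_pos : 0 < P.g - K.kp - K.kv := by linarith [hK.lt_g]
  have γ₂_nonneg := hγ.trans hγ₂
  have ρ_nonneg := (norm_nonneg _).trans hρ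
  have feedforward_le : ‖feedforwardErr P K X‖
      ≤ 2 * (4 / (P.g - K.kp - K.kv) * (K.kv * ρ)) * ‖(Qerr P K X).2‖ := by
    calc _ ≤ 4 / (P.g - K.kp - K.kv) * (K.kv * (2 * ‖(Qerr P K X).2‖ * ρ)) :=
          (hK.norm_feedforwardErr_le hQ).trans (by gcongr)
      _ = _ := by ring
  rw [hK.attLyapunov_eq hQ]
  refine coupledRate_le (hK.isUnitQuat_Qerr hQ).norm_snd_le_one ha hD hw hγ hθ
    ((hK.attErrRate_le hQ hγ hγ₁ hγ₂ hW).trans ?_) ((hK.filterErrRate_le hQ r').trans ?_) hΛγ hΛk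
  all_goals gcongr

end

lemma NonCollinear.mul_norm_sq_le {cw : ℝ → ℝ → ℝ} {P : Vehicle} {K : Gains} {J : Set ℝ}
    {x : ℝ → State} (hN : NonCollinear cw P K J x) {t : ℝ} (ht : t ∈ J) (y : E3) :
    cw 1 1 * ‖y‖ ^ 2 ≤ ‖cross y P.r₁‖ ^ 2 + ‖cross y (r2 P K (x t))‖ ^ 2 := by
  calc cw 1 1 * ‖y‖ ^ 2 ≤ lambdaMin (W 1 1 P.r₁ (r2 P K (x t))) * ‖y‖ ^ 2 := by
        gcongr
        exact (hN 1 1 one_pos one_pos t ht).le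
    _ ≤ inner ℝ y (act (W 1 1 P.r₁ (r2 P K (x t))) y) :=
        lambdaMin_mul_norm_sq_le (isHermitian_W 1 1 _ _) y
    _ = _ := by rw [inner_act_W, one_mul, one_mul]

/-! ### Choice of the observer gains -/

section Gains

variable {P : Vehicle} {kp kv c₁ c₂ c₃ : ℝ}

lemma exists_r2Rate_le (hkp : 0 < kp) (hkv : 0 < kv) (hg : kp + kv < P.g) {γ₁ γ₂ : ℝ}
    (hγ₁ : 0 ≤ γ₁) (hγ₂ : 0 ≤ γ₂) (vb : ℝ) {ρ : ℝ} (hρ : 0 ≤ ρ) :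
    ∃ A D : ℝ, 0 ≤ D ∧ ∀ (k₁ : ℝ) (X : State), IsUnitQuat X.Q → ‖X.v‖ ≤ vb →
      ‖r2 P ⟨kp, kv, γ₁, γ₂, k₁⟩ X‖ ≤ ρ →
      ‖muRate P ⟨kp, kv, γ₁, γ₂, k₁⟩ X‖
          + uT P ⟨kp, kv, γ₁, γ₂, k₁⟩ X * ‖omega P ⟨kp, kv, γ₁, γ₂, k₁⟩ X‖
        ≤ A + D * ‖r2err P ⟨kp, kv, γ₁, γ₂, k₁⟩ X‖ := by
  have margin_pos : 0 < P.g - kp - kv := by linarith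
  have g_pos : 0 < P.g := by linarith
  set μ := kp * vb + kv * (P.g + ρ)
  refine ⟨μ + (P.g + kp + kv) * (4 / (P.g - kp - kv) * (μ + kv * (2 * ρ))
      + (γ₁ * (‖P.r₁‖ * ‖P.r₁‖) + γ₂ * (ρ * ρ))), (P.g + kp + kv) * γ₂ * ρ, by positivity,
    fun k₁ X hQ hv hr => ?_⟩
  set K : Gains := ⟨kp, kv, γ₁, γ₂, k₁⟩
  have hK : ThrustMargin P K := ⟨hkp, hkv, hg⟩
  have muRate_le : ‖muRate P K X‖ ≤ μ :=
    (hK.norm_muRate_le X).trans (add_le_add (mul_le_mul_of_nonneg_left hv hkp.le)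
      (mul_le_mul_of_nonneg_left (by gcongr) hkv.le))
  have psi_le : ‖psi P K X‖ ≤ γ₁ * (‖P.r₁‖ * ‖P.r₁‖) + γ₂ * (ρ * ρ)
      + γ₂ * (‖r2err P K X‖ * ρ) := (hK.norm_psi_le hQ hγ₁ hγ₂).trans (by gcongr)
  have omega_le : ‖omega P K X‖ ≤ 4 / (P.g - kp - kv) * (μ + kv * (2 * ρ))
      + (γ₁ * (‖P.r₁‖ * ‖P.r₁‖) + γ₂ * (ρ * ρ) + γ₂ * (‖r2err P K X‖ * ρ)) :=
    (hK.norm_omega_le hQ).trans (by gcongr)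
  have gyration_le := mul_le_mul (hK.uT_le X) omega_le (norm_nonneg _)
    (by positivity : 0 ≤ P.g + kp + kv)
  linarith

lemma exists_r2_hasDerivWithinAt_le (hkp : 0 < kp) (hkv : 0 < kv) (hg : kp + kv < P.g)
    (hc₁ : 0 ≤ c₁) (hc₃ : 0 ≤ c₃) (hδ : ∀ v, ‖P.δ v‖ ≤ c₁ * ‖v‖ ^ 2) {γ₁ γ₂ : ℝ}
    (hγ₁ : 0 ≤ γ₁) (hγ₂ : 0 ≤ γ₂) (vb : ℝ) :
    ∃ A D : ℝ, 0 ≤ D ∧ ∀ (k₁ : ℝ) (J : Set ℝ) (x : ℝ → State),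
      IsSolution P ⟨kp, kv, γ₁, γ₂, k₁⟩ J x → DisturbanceRate c₂ c₃ P J x →
      ∀ t ∈ J, IsUnitQuat (x t).Q → ∃ r' : E3,
        HasDerivWithinAt (fun s => r2 P ⟨kp, kv, γ₁, γ₂, k₁⟩ (x s)) r' J t ∧
        (‖(x t).v‖ ≤ vb →
          ‖r2 P ⟨kp, kv, γ₁, γ₂, k₁⟩ (x t)‖ ≤ P.g + kp + kv + c₁ * vb ^ 2 ∧
          ‖r'‖ ≤ A + D * ‖r2err P ⟨kp, kv, γ₁, γ₂, k₁⟩ (x t)‖) := by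
  set ρ := P.g + kp + kv + c₁ * vb ^ 2
  have ρ_nonneg : 0 ≤ ρ := by
    have : 0 < P.g := by linarith
    positivity
  obtain ⟨A, D, hD, rate_le⟩ := exists_r2Rate_le hkp hkv hg hγ₁ hγ₂ vb ρ_nonneg
  refine ⟨A + (c₂ + c₃ * vb ^ 3), D, hD, fun k₁ J x hx hdist t ht hQ => ?_⟩
  have hK : ThrustMargin P ⟨kp, kv, γ₁, γ₂, k₁⟩ := ⟨hkp, hkv, hg⟩
  obtain ⟨r', r2_deriv, r'_le⟩ :=
    hx.exists_hasDerivWithinAt_r2 hK ht hQ (hdist t ht).1.hasDerivWithinAt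
  refine ⟨r', r2_deriv, fun hv => ?_⟩
  have r2_le : ‖r2 P ⟨kp, kv, γ₁, γ₂, k₁⟩ (x t)‖ ≤ ρ := by
    refine (norm_r2_le hQ).trans (add_le_add (hK.uT_le _) ((hδ _).trans ?_))
    gcongr
  have disturbance_le := (hdist t ht).2.le.trans (b := c₂ + c₃ * ‖(x t).v‖ ^ 3)
    (c := c₂ + c₃ * vb ^ 3) (by gcongr)
  exact ⟨r2_le, by linarith [rate_le k₁ (x t) hQ hv r2_le]⟩

lemma exists_gains_attLyapunovRate_le (hkp : 0 < kp) (hkv : 0 < kv) (hg : kp + kv < P.g)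
    (hc₁ : 0 ≤ c₁) (hc₃ : 0 ≤ c₃) (hδ : ∀ v, ‖P.δ v‖ ≤ c₁ * ‖v‖ ^ 2) {cw : ℝ → ℝ → ℝ}
    (hcw : 0 < cw 1 1) (vb : ℝ) {θ Λ : ℝ} (hθ : 0 < θ) (hΛ : 0 < Λ) :
    ∃ γbar : ℝ, 0 < γbar ∧ ∀ γ₁ > γbar, ∀ γ₂ > γbar, ∀ a > 0, ∃ κ : ℝ, 0 < κ ∧ ∀ k₁ > κ,
      ∀ (J : Set ℝ) (x : ℝ → State), IsSolution P ⟨kp, kv, γ₁, γ₂, k₁⟩ J x →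
      (∀ t ∈ J, IsUnitQuat (x t).Q) → NonCollinear cw P ⟨kp, kv, γ₁, γ₂, k₁⟩ J x →
      DisturbanceRate c₂ c₃ P J x → ∀ t ∈ J, ∃ L' : ℝ,
        HasDerivWithinAt (fun s => attLyapunov a P ⟨kp, kv, γ₁, γ₂, k₁⟩ (x s)) L' J t ∧
        (‖(x t).v‖ ≤ vb → θ ≤ (Qerr P ⟨kp, kv, γ₁, γ₂, k₁⟩ (x t)).1 ^ 2 →
          L' ≤ -(Λ * attLyapunov a P ⟨kp, kv, γ₁, γ₂, k₁⟩ (x t))) := by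
  have margin_pos : 0 < P.g - kp - kv := by linarith
  have g_pos : 0 < P.g := by linarith
  set ρ := P.g + kp + kv + c₁ * vb ^ 2
  set F := 4 / (P.g - kp - kv) * (kv * ρ)
  have F_nonneg : 0 ≤ F := by positivity
  refine ⟨(Λ + 1 + 2 * F) / (2 * θ * cw 1 1), by positivity, fun γ₁ hγ₁ γ₂ hγ₂ a ha => ?_⟩
  set γbar := (Λ + 1 + 2 * F) / (2 * θ * cw 1 1) with γbar_def
  have γbar_pos : 0 < γbar := by positivity
  obtain ⟨A, D, hD, r2_bound⟩ := exists_r2_hasDerivWithinAt_le (c₂ := c₂) hkp hkv hg hc₁ hc₃ hδ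
    (γbar_pos.trans hγ₁).le (γbar_pos.trans hγ₂).le vb
  set G := γ₂ * ρ + 4 * a * (F * ρ + A)
  refine ⟨2 * D + (G ^ 2 / 4 + a * Λ) / (2 * a), by positivity,
    fun k₁ hk₁ J x hx hQ hN hdist t ht => ?_⟩
  have hK : ThrustMargin P ⟨kp, kv, γ₁, γ₂, k₁⟩ := ⟨hkp, hkv, hg⟩
  have k₁_pos : 0 < k₁ := lt_of_le_of_lt (by positivity) hk₁
  obtain ⟨r', r2_deriv, r2_bounds⟩ := r2_bound k₁ J x hx hdist t ht (hQ t ht)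
  refine ⟨_, hx.hasDerivWithinAt_attLyapunov hK hQ k₁_pos.ne' ht r2_deriv a, fun hv hη => ?_⟩
  have γbar_dominates : Λ + 1 + 2 * F ≤ 2 * θ * (γbar * cw 1 1) := by
    rw [γbar_def]
    exact le_of_eq (by field_simp)
  have k₁_dominates : G ^ 2 / 4 + a * Λ ≤ 2 * a * (k₁ - 2 * D) := by
    rw [gt_iff_lt, ← lt_sub_iff_add_lt', div_lt_iff₀ (by positivity)] at hk₁
    linarith
  exact hK.attLyapunovRate_le (hQ t ht) ha.le hD hcw.le γbar_pos.le hγ₁.le hγ₂.le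
    (hN.mul_norm_sq_le ht) (r2_bounds hv).1 (r2_bounds hv).2 hη γbar_dominates k₁_dominates

end Gains

/-! ### Boundedness -/

lemma mul_le_half_mul_sq_add {σ : ℝ} (hσ : 0 < σ) (x y : ℝ) :
    x * y ≤ σ / 2 * x ^ 2 + y ^ 2 / (2 * σ) := by
  have square : σ / 2 * x ^ 2 + y ^ 2 / (2 * σ) - x * y = (σ * x - y) ^ 2 / (2 * σ) := by
    field_simp
    ring
  have square_nonneg : 0 ≤ (σ * x - y) ^ 2 / (2 * σ) := by positivity
  linarith

lemma div_sqrt_mul_sqrt_le {k y b : ℝ} (hk : 0 ≤ k) (hy : 0 ≤ y) (hb : y ≤ b) :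
    k / √(1 + b ^ 2) * √(1 + y ^ 2) ≤ k := by
  calc k / √(1 + b ^ 2) * √(1 + y ^ 2) ≤ k / √(1 + b ^ 2) * √(1 + b ^ 2) := by gcongr
    _ = k := div_mul_cancel₀ k (by positivity)

lemma half_mul_sq_le_mul_sqrt_one_add_sub_one {κ k y : ℝ} (hκ : 0 ≤ κ)
    (hκk : κ * √(1 + y ^ 2) ≤ k) : κ / 2 * y ^ 2 ≤ k * (√(1 + y ^ 2) - 1) := by
  have one_le : 1 ≤ √(1 + y ^ 2) := Real.one_le_sqrt.2 (by linarith [sq_nonneg y])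
  have sq_sqrt : √(1 + y ^ 2) ^ 2 = 1 + y ^ 2 := Real.sq_sqrt (by positivity)
  calc κ / 2 * y ^ 2 = κ / 2 * (√(1 + y ^ 2) + 1) * (√(1 + y ^ 2) - 1) := by
        linear_combination -(κ / 2) * sq_sqrt
    _ ≤ κ * √(1 + y ^ 2) * (√(1 + y ^ 2) - 1) := by
        refine mul_le_mul_of_nonneg_right ?_ (sub_nonneg.2 one_le)
        linarith [mul_le_mul_of_nonneg_left one_le hκ]
    _ ≤ k * (√(1 + y ^ 2) - 1) := mul_le_mul_of_nonneg_right hκk (sub_nonneg.2 one_le)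

section Energy

variable {P : Vehicle} {K : Gains} {X : State} {kp : ℝ}

lemma potential_nonneg (hkp : 0 ≤ kp) (P : Vehicle) (X : State) :
    0 ≤ kp * (√(1 + ‖eP P X‖ ^ 2) - 1) :=
  mul_nonneg hkp (sub_nonneg.2 (one_le_sqrt_one_add_norm_sq _))

lemma norm_v_le_sqrt_energy (hkp : 0 ≤ kp) (P : Vehicle) (X : State) :
    ‖X.v‖ ≤ √(2 * energy P kp X) := by
  refine Real.le_sqrt_of_sq_le ?_
  rw [energy]
  linarith [potential_nonneg hkp P X]

lemma norm_eP_le_energy_div (hkp : 0 < kp) (P : Vehicle) (X : State) :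
    ‖eP P X‖ ≤ energy P kp X / kp + 1 := by
  have norm_le_sqrt : ‖eP P X‖ ≤ √(1 + ‖eP P X‖ ^ 2) := Real.le_sqrt_of_sq_le (by linarith)
  have sqrt_le : √(1 + ‖eP P X‖ ^ 2) - 1 ≤ energy P kp X / kp := by
    rw [le_div_iff₀' hkp]
    exact le_add_of_nonneg_right (by positivity)
  linarith

lemma ThrustMargin.energyRate_le_of_damping (hK : ThrustMargin P K) (hQ : IsUnitQuat X.Q)
    (hδ : inner ℝ (P.δ X.v) X.v ≤ 0) {σ : ℝ} (hσ : 0 < σ) (hv : σ * √(1 + ‖X.v‖ ^ 2) ≤ K.kv) :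
    K.kp * inner ℝ (h (eP P X)) X.v + inner ℝ X.v (P.g • e3 + r2 P K X)
      ≤ -(σ / 2 * ‖X.v‖ ^ 2) + 2 * ((P.g + K.kp + K.kv) ^ 2 / σ) * ‖(Qerr P K X).2‖ ^ 2 := by
  have damping : σ * ‖X.v‖ ^ 2 ≤ K.kv * (‖X.v‖ ^ 2 / √(1 + ‖X.v‖ ^ 2)) := by
    rw [← le_div_iff₀ (sqrt_one_add_norm_sq_pos X.v)] at hv
    calc σ * ‖X.v‖ ^ 2 ≤ K.kv / √(1 + ‖X.v‖ ^ 2) * ‖X.v‖ ^ 2 := by gcongr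
      _ = _ := by ring
  have coupling := mul_le_half_mul_sq_add hσ ‖X.v‖
    ((P.g + K.kp + K.kv) * (2 * ‖(Qerr P K X).2‖))
  have coupling_sq : ((P.g + K.kp + K.kv) * (2 * ‖(Qerr P K X).2‖)) ^ 2 / (2 * σ)
      = 2 * ((P.g + K.kp + K.kv) ^ 2 / σ) * ‖(Qerr P K X).2‖ ^ 2 := by
    field_simp
  linarith [hK.energyRate_le hQ hδ]

lemma ThrustMargin.energy_le_of_add_attLyapunov_le (hK : ThrustMargin P K)
    (hQ : IsUnitQuat X.Q) {a θ E₁ : ℝ} (ha : 0 ≤ a)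
    (hE : energy P K.kp X + 1 / 2 * attLyapunov a P K X ≤ E₁)
    (hL : attLyapunov a P K X ≤ 1 - θ) :
    energy P K.kp X ≤ E₁ ∧ ‖X.v‖ ≤ √(2 * E₁) ∧ θ ≤ (Qerr P K X).1 ^ 2 := by
  have energy_le : energy P K.kp X ≤ E₁ := by
    linarith [(sq_nonneg _).trans (hK.norm_Qerr_snd_sq_le_attLyapunov hQ ha)]
  have attErr_le := (one_sub_Qerr_fst_sq_le_attLyapunov ha).trans hL
  exact ⟨energy_le, (norm_v_le_sqrt_energy hK.kp_pos.le P X).trans (by gcongr), by linarith⟩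

end Energy

lemma IsSolution.energy_le_of_attLyapunovRate_le {P : Vehicle} {K : Gains} {t₀ : ℝ} {T : EReal}
    {x : ℝ → State} {a θ σ Λ vb : ℝ} {L' : ℝ → ℝ}
    (hx : IsSolution P K (timeInterval t₀ T) x) (hK : ThrustMargin P K)
    (hQ : ∀ t ∈ timeInterval t₀ T, IsUnitQuat (x t).Q) (hδ : ∀ v, inner ℝ (P.δ v) v ≤ 0)
    (ha : 0 ≤ a) (hσ : 0 < σ) (hΛ : 4 * ((P.g + K.kp + K.kv) ^ 2 / σ) ≤ Λ)
    (hvb : √(2 * (energy P K.kp (x t₀) + 1)) ≤ vb) (hσv : σ * √(1 + vb ^ 2) ≤ K.kv)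
    (hθ : 0 ≤ θ) (hθ₀ : attLyapunov a P K (x t₀) < 1 - θ)
    (hL : ∀ t ∈ timeInterval t₀ T,
      HasDerivWithinAt (fun s => attLyapunov a P K (x s)) (L' t) (timeInterval t₀ T) t)
    (hL' : ∀ t ∈ timeInterval t₀ T, ‖(x t).v‖ ≤ vb → θ ≤ (Qerr P K (x t)).1 ^ 2 →
      L' t ≤ -(Λ * attLyapunov a P K (x t))) :
    ∀ t ∈ timeInterval t₀ T, energy P K.kp (x t) ≤ energy P K.kp (x t₀) + 1 ∧
      ‖(x t).v‖ ≤ vb ∧ L' t ≤ -(Λ * attLyapunov a P K (x t)) := by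
  have bounds : ∀ t ∈ timeInterval t₀ T,
      energy P K.kp (x t) + 1 / 2 * attLyapunov a P K (x t) ≤ energy P K.kp (x t₀) + 1 →
      attLyapunov a P K (x t) ≤ 1 - θ → energy P K.kp (x t) ≤ energy P K.kp (x t₀) + 1 ∧
        ‖(x t).v‖ ≤ vb ∧ L' t ≤ -(Λ * attLyapunov a P K (x t)) := by
    intro t ht hE hLt
    obtain ⟨E_le, v_le, θ_le⟩ := hK.energy_le_of_add_attLyapunov_le (hQ t ht) ha hE hLt
    exact ⟨E_le, v_le.trans hvb, hL' t ht (v_le.trans hvb) θ_le⟩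
  have rates_nonpos : ∀ t ∈ timeInterval t₀ T,
      energy P K.kp (x t) + 1 / 2 * attLyapunov a P K (x t) < energy P K.kp (x t₀) + 1 →
      attLyapunov a P K (x t) < 1 - θ →
      K.kp * inner ℝ (h (eP P (x t))) (x t).v + inner ℝ (x t).v (P.g • e3 + r2 P K (x t))
        + 1 / 2 * L' t ≤ 0 ∧ L' t ≤ 0 := by
    intro t ht hE hLt
    obtain ⟨-, v_le, rate_le⟩ := bounds t ht hE.le hLt.le
    have q_sq_le := hK.norm_Qerr_snd_sq_le_attLyapunov (hQ t ht) ha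
    have Λ_nonneg : 0 ≤ Λ := le_trans (by positivity) hΛ
    have L_nonneg := (sq_nonneg _).trans q_sq_le
    have attitude_le := mul_le_mul hΛ q_sq_le (sq_nonneg _) Λ_nonneg
    have energyRate_le := hK.energyRate_le_of_damping (hQ t ht) (hδ _) hσ
      (le_trans (by gcongr) hσv)
    have speed_nonneg : 0 ≤ σ / 2 * ‖(x t).v‖ ^ 2 := by positivity
    exact ⟨by linarith, rate_le.trans (neg_nonpos.2 (by positivity))⟩
  have monotone := le_initial_of_bootstrap
    (fun t ht => (hx.hasDerivWithinAt_energy ht).fun_add ((hL t ht).const_mul (1 / 2))) hL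
    (by linarith) hθ₀ rates_nonpos
  exact fun t ht => bounds t ht (by linarith [(monotone t ht).1]) ((monotone t ht).2.trans hθ₀.le)

/-! ### Convergence -/

/-- The strict Lyapunov function of the closed loop: the cross term `⟨e_p, v⟩` makes its rate
negative in `e_p` as well, and the attitude term absorbs the coupling to `q̃`. -/
def strictLyapunov (α n a : ℝ) (P : Vehicle) (K : Gains) (X : State) : ℝ :=
  energy P K.kp X + α * inner ℝ (eP P X) X.v + n * attLyapunov a P K X

/-- Weights `α`, `n` for which `strictLyapunov` decays at the rate `β`, when `σ` and `κ` are the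
damping and stiffness of the translational subsystem, `b` bounds its velocity feedback, `c` its
coupling to the attitude error, and `attLyapunov` decays at the rate `Λ`. -/
structure StrictWeights (kp σ κ b c Λ α n β : ℝ) : Prop where
  α_pos : 0 < α
  n_pos : 0 < n
  β_pos : 0 < β
  α_le_half : α ≤ 1 / 2
  α_le_stiffness : α ≤ κ / 2
  damping : α * (1 + b ^ 2 / κ) ≤ σ / 4
  attitude : 2 * (c ^ 2 / σ) + 4 * α * (c ^ 2 / κ) + 1 ≤ n * Λ
  rate_le_damping : β * (kp + 1 + n) ≤ σ / 4
  rate_le_stiffness : β * (kp + 1 + n) ≤ α * κ / 2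
  rate_le_one : β * (kp + 1 + n) ≤ 1

lemma exists_strictWeights {kp σ κ Λ : ℝ} (hkp : 0 ≤ kp) (hσ : 0 < σ) (hκ : 0 < κ) (hΛ : 0 < Λ)
    (b c : ℝ) : ∃ α n β : ℝ, StrictWeights kp σ κ b c Λ α n β := by
  have factor_pos : 0 < 1 + b ^ 2 / κ := by positivity
  set α := min (1 / 2) (min (κ / 2) (σ / 4 / (1 + b ^ 2 / κ)))
  have α_pos : 0 < α := by positivity
  set n := (2 * (c ^ 2 / σ) + 4 * α * (c ^ 2 / κ) + 1) / Λ
  have n_pos : 0 < n := by positivity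
  have H_pos : 0 < kp + 1 + n := by positivity
  set m := min (σ / 4) (min (α * κ / 2) 1)
  have rate_eq : m / (kp + 1 + n) * (kp + 1 + n) = m := div_mul_cancel₀ m H_pos.ne'
  exact ⟨α, n, m / (kp + 1 + n),
    { α_pos, n_pos
      β_pos := div_pos (by positivity) H_pos
      α_le_half := min_le_left _ _
      α_le_stiffness := (min_le_right _ _).trans (min_le_left _ _)
      damping := (le_div_iff₀ factor_pos).1 ((min_le_right _ _).trans (min_le_right _ _))
      attitude := (div_mul_cancel₀ _ hΛ.ne').ge
      rate_le_damping := rate_eq.trans_le (min_le_left _ _)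
      rate_le_stiffness := rate_eq.trans_le ((min_le_right _ _).trans (min_le_left _ _))
      rate_le_one := rate_eq.trans_le ((min_le_right _ _).trans (min_le_right _ _)) }⟩

section StrictLyapunov

variable {P : Vehicle} {K : Gains} {X : State} {α n a κ : ℝ}

lemma abs_inner_le_half_add (u v : E3) : |inner ℝ u v| ≤ (‖u‖ ^ 2 + ‖v‖ ^ 2) / 2 := by
  linarith [abs_real_inner_le_norm u v, two_mul_le_add_sq ‖u‖ ‖v‖]

lemma le_strictLyapunov (hκ : 0 ≤ κ) (hκe : κ * √(1 + ‖eP P X‖ ^ 2) ≤ K.kp) (hα : 0 ≤ α)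
    (hα_half : α ≤ 1 / 2) (hακ : α ≤ κ / 2) (hnL : 0 ≤ n * attLyapunov a P K X) :
    κ / 4 * ‖eP P X‖ ^ 2 + 1 / 4 * ‖X.v‖ ^ 2 ≤ strictLyapunov α n a P K X := by
  have potential_ge := half_mul_sq_le_mul_sqrt_one_add_sub_one hκ hκe
  have cross_ge := mul_le_mul_of_nonneg_left
    (neg_le_of_abs_le (abs_inner_le_half_add (eP P X) X.v)) hα
  have position_share : α * ‖eP P X‖ ^ 2 ≤ κ / 2 * ‖eP P X‖ ^ 2 := by gcongr
  have velocity_share : α * ‖X.v‖ ^ 2 ≤ 1 / 2 * ‖X.v‖ ^ 2 := by gcongr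
  rw [strictLyapunov, energy]
  linarith

lemma strictLyapunov_le (hkp : 0 ≤ K.kp) (hα : 0 ≤ α) (hα_half : α ≤ 1 / 2) (hn : 0 ≤ n)
    (hL : 0 ≤ attLyapunov a P K X) :
    strictLyapunov α n a P K X
      ≤ (K.kp + 1 + n) * (‖eP P X‖ ^ 2 + ‖X.v‖ ^ 2 + attLyapunov a P K X) := by
  have sqrt_le : √(1 + ‖eP P X‖ ^ 2) ≤ 1 + ‖eP P X‖ ^ 2 :=
    Real.sqrt_le_iff.2 ⟨by positivity,
      le_self_pow₀ (le_add_of_nonneg_right (by positivity)) two_ne_zero⟩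
  have potential_le : K.kp * (√(1 + ‖eP P X‖ ^ 2) - 1) ≤ K.kp * ‖eP P X‖ ^ 2 := by
    gcongr
    linarith
  have cross_le := mul_le_mul_of_nonneg_left
    (le_of_abs_le (abs_inner_le_half_add (eP P X) X.v)) hα
  have cross_share : α * ((‖eP P X‖ ^ 2 + ‖X.v‖ ^ 2) / 2)
      ≤ 1 / 2 * ((‖eP P X‖ ^ 2 + ‖X.v‖ ^ 2) / 2) := by gcongr
  have remainder_nonneg : 0 ≤ K.kp * (‖X.v‖ ^ 2 + attLyapunov a P K X)
      + n * (‖eP P X‖ ^ 2 + ‖X.v‖ ^ 2) + attLyapunov a P K X := by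
    positivity
  rw [strictLyapunov, energy]
  linarith [sq_nonneg ‖eP P X‖, sq_nonneg ‖X.v‖]

lemma ThrustMargin.inner_eP_acceleration_le (hK : ThrustMargin P K) (hQ : IsUnitQuat X.Q)
    {d : ℝ} (hδ : ‖P.δ X.v‖ ≤ d * ‖X.v‖) (hκ : 0 < κ)
    (hκe : κ * √(1 + ‖eP P X‖ ^ 2) ≤ K.kp) :
    inner ℝ (eP P X) (P.g • e3 + r2 P K X)
      ≤ -(κ / 2 * ‖eP P X‖ ^ 2) + (K.kv + d) ^ 2 / κ * ‖X.v‖ ^ 2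
        + 4 * ((P.g + K.kp + K.kv) ^ 2 / κ) * ‖(Qerr P K X).2‖ ^ 2 := by
  set b := K.kv + d
  set c := P.g + K.kp + K.kv
  set q := ‖(Qerr P K X).2‖
  set thrustErr := uT P K X • (act (rot X.Q).transpose e3
    - act (rot (Qerr P K X)) (act (rot X.Q).transpose e3))
  have stiffness : κ * ‖eP P X‖ ^ 2 ≤ K.kp * (‖eP P X‖ ^ 2 / √(1 + ‖eP P X‖ ^ 2)) := by
    rw [← le_div_iff₀ (sqrt_one_add_norm_sq_pos (eP P X))] at hκe
    calc κ * ‖eP P X‖ ^ 2 ≤ K.kp / √(1 + ‖eP P X‖ ^ 2) * ‖eP P X‖ ^ 2 := by gcongr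
      _ = _ := by ring
  have disturbance_le : ‖-(K.kv • h X.v) + P.δ X.v - thrustErr‖ ≤ b * ‖X.v‖ + c * (2 * q) := by
    have feedback_le : ‖K.kv • h X.v‖ ≤ K.kv * ‖X.v‖ := by
      rw [norm_smul, Real.norm_of_nonneg hK.kv_pos.le]
      exact mul_le_mul_of_nonneg_left (norm_h_le X.v) hK.kv_pos.le
    rw [← norm_neg] at feedback_le
    exact norm_sub_le_of_le (norm_add_le_of_le feedback_le hδ) (hK.norm_thrustErr_le hQ)
      |>.trans_eq (by ring)
  have young := mul_le_half_mul_sq_add hκ ‖eP P X‖ (b * ‖X.v‖ + c * (2 * q))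
  have young_sq : (b * ‖X.v‖ + c * (2 * q)) ^ 2 / (2 * κ)
      ≤ b ^ 2 / κ * ‖X.v‖ ^ 2 + 4 * (c ^ 2 / κ) * q ^ 2 := by
    rw [div_le_iff₀ (by positivity)]
    calc _ ≤ 2 * ((b * ‖X.v‖) ^ 2 + (c * (2 * q)) ^ 2) := add_sq_le
      _ = _ := by field_simp; ring
  have force_eq : P.g • e3 + r2 P K X
      = -(K.kp • h (eP P X)) + (-(K.kv • h X.v) + P.δ X.v - thrustErr) := by
    rw [hK.acceleration_eq_muD_add hQ, muD]
    abel
  rw [force_eq, inner_add_right, inner_neg_right, inner_smul_right, inner_self_h]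
  have work_le := (real_inner_le_norm (eP P X) _).trans
    (mul_le_mul_of_nonneg_left disturbance_le (norm_nonneg (eP P X)))
  linarith

lemma ThrustMargin.strictLyapunovRate_le (hK : ThrustMargin P K) (hQ : IsUnitQuat X.Q)
    {d σ Λ β L' : ℝ} (hδ_diss : inner ℝ (P.δ X.v) X.v ≤ 0) (hδ : ‖P.δ X.v‖ ≤ d * ‖X.v‖)
    (hσ : 0 < σ) (hσv : σ * √(1 + ‖X.v‖ ^ 2) ≤ K.kv) (hκ : 0 < κ)
    (hκe : κ * √(1 + ‖eP P X‖ ^ 2) ≤ K.kp) (ha : 0 ≤ a)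
    (hw : StrictWeights K.kp σ κ (K.kv + d) (P.g + K.kp + K.kv) Λ α n β)
    (hL' : L' ≤ -(Λ * attLyapunov a P K X)) :
    K.kp * inner ℝ (h (eP P X)) X.v + inner ℝ X.v (P.g • e3 + r2 P K X)
        + α * (inner ℝ (eP P X) (P.g • e3 + r2 P K X) + inner ℝ X.v X.v) + n * L'
      ≤ -(β * strictLyapunov α n a P K X) := by
  have q_sq_le := hK.norm_Qerr_snd_sq_le_attLyapunov hQ ha
  have L_nonneg := (sq_nonneg _).trans q_sq_le
  have α_pos := hw.α_pos
  have energyRate_le := hK.energyRate_le_of_damping hQ hδ_diss hσ hσv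
  have crossRate_le := mul_le_mul_of_nonneg_left
    (hK.inner_eP_acceleration_le hQ hδ hκ hκe) hw.α_pos.le
  have attitudeRate_le := mul_le_mul_of_nonneg_left hL' hw.n_pos.le
  have velocity_share := mul_le_mul_of_nonneg_right hw.damping (sq_nonneg ‖X.v‖)
  have attitude_share := mul_le_mul_of_nonneg_right hw.attitude L_nonneg
  have coupling_le : (2 * ((P.g + K.kp + K.kv) ^ 2 / σ) + 4 * α * ((P.g + K.kp + K.kv) ^ 2 / κ))
        * ‖(Qerr P K X).2‖ ^ 2
      ≤ (2 * ((P.g + K.kp + K.kv) ^ 2 / σ) + 4 * α * ((P.g + K.kp + K.kv) ^ 2 / κ))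
        * attLyapunov a P K X := by gcongr
  have Z_le := mul_le_mul_of_nonneg_left
    (strictLyapunov_le (X := X) hK.kp_pos.le hw.α_pos.le hw.α_le_half hw.n_pos.le L_nonneg)
    hw.β_pos.le
  have velocity_rate := mul_le_mul_of_nonneg_right hw.rate_le_damping (sq_nonneg ‖X.v‖)
  have position_rate := mul_le_mul_of_nonneg_right hw.rate_le_stiffness (sq_nonneg ‖eP P X‖)
  have attitude_rate := mul_le_mul_of_nonneg_right hw.rate_le_one L_nonneg
  rw [real_inner_self_eq_norm_sq]
  linarith

end StrictLyapunov

theorem IsSolution.tendsto_zero {P : Vehicle} {K : Gains} {t₀ : ℝ} {x : ℝ → State}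
    {a d σ κ Λ : ℝ} {L' : ℝ → ℝ} (hx : IsSolution P K (Set.Ici t₀) x) (hK : ThrustMargin P K)
    (hQ : ∀ t ∈ Set.Ici t₀, IsUnitQuat (x t).Q) (hδ_diss : ∀ v, inner ℝ (P.δ v) v ≤ 0)
    (hδ : ∀ t ∈ Set.Ici t₀, ‖P.δ (x t).v‖ ≤ d * ‖(x t).v‖)
    (hσ : 0 < σ) (hσv : ∀ t ∈ Set.Ici t₀, σ * √(1 + ‖(x t).v‖ ^ 2) ≤ K.kv)
    (hκ : 0 < κ) (hκe : ∀ t ∈ Set.Ici t₀, κ * √(1 + ‖eP P (x t)‖ ^ 2) ≤ K.kp)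
    (ha : 0 ≤ a) (hΛ : 0 < Λ)
    (hL : ∀ t ∈ Set.Ici t₀,
      HasDerivWithinAt (fun s => attLyapunov a P K (x s)) (L' t) (Set.Ici t₀) t)
    (hL' : ∀ t ∈ Set.Ici t₀, L' t ≤ -(Λ * attLyapunov a P K (x t))) :
    Filter.Tendsto (fun t => eP P (x t)) Filter.atTop (nhds 0) ∧
      Filter.Tendsto (fun t => (x t).v) Filter.atTop (nhds 0) := by
  obtain ⟨α, n, β, hw⟩ := exists_strictWeights hK.kp_pos.le hσ hκ hΛ (K.kv + d)
    (P.g + K.kp + K.kv)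
  set Z := fun t => strictLyapunov α n a P K (x t)
  have Z_deriv := fun t ht => ((hx.hasDerivWithinAt_energy ht).fun_add
    (((hx.hasDerivWithinAt_eP ht).inner ℝ (hx.hasDerivWithinAt_v ht)).const_mul α)).fun_add
    ((hL t ht).const_mul n)
  have Z_decay : ∀ t, t₀ ≤ t → Z t ≤ Z t₀ * Real.exp (-(β * (t - t₀))) := fun t ht =>
    le_exp_of_deriv_le Z_deriv (fun s hs => hK.strictLyapunovRate_le (hQ s hs) (hδ_diss _)
      (hδ s hs) hσ (hσv s hs) hκ (hκe s hs) ha hw (hL' s hs)) ht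
  have le_Z : ∀ t, t₀ ≤ t → κ / 4 * ‖eP P (x t)‖ ^ 2 + 1 / 4 * ‖(x t).v‖ ^ 2 ≤ Z t := by
    intro t ht
    have L_nonneg := (sq_nonneg _).trans (hK.norm_Qerr_snd_sq_le_attLyapunov (hQ t ht) ha)
    exact le_strictLyapunov hκ.le (hκe t ht) hw.α_pos.le hw.α_le_half hw.α_le_stiffness
      (mul_nonneg hw.n_pos.le L_nonneg)
  refine ⟨tendsto_zero_of_sq_le_exp (t₀ := t₀) (C := 4 / κ * Z t₀) hw.β_pos fun t ht => ?_,
    tendsto_zero_of_sq_le_exp (t₀ := t₀) (C := 4 * Z t₀) hw.β_pos fun t ht => ?_⟩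
  · calc ‖eP P (x t)‖ ^ 2 = 4 / κ * (κ / 4 * ‖eP P (x t)‖ ^ 2) := by field_simp
      _ ≤ 4 / κ * (Z t₀ * Real.exp (-(β * (t - t₀)))) := by
          refine mul_le_mul_of_nonneg_left ?_ (by positivity)
          linarith [le_Z t ht, Z_decay t ht, sq_nonneg ‖(x t).v‖]
      _ = _ := by ring
  · have position_nonneg : 0 ≤ κ / 4 * ‖eP P (x t)‖ ^ 2 := by positivity
    linarith [le_Z t ht, Z_decay t ht]

/-! ### Semiglobal boundedness and convergence -/

lemma attLyapunov_lt_of_filterErr_le {P : Vehicle} {K : Gains} {X : State} {ε B : ℝ}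
    (hε : 0 < ε) (hη : ε ≤ |(Qerr P K X).1|) (hB : ‖r2err P K X‖ ≤ B) :
    attLyapunov (ε ^ 2 / (2 * (B ^ 2 + 1))) P K X < 1 - ε ^ 2 / 2 := by
  have η_sq_ge : ε ^ 2 ≤ (Qerr P K X).1 ^ 2 := by
    rw [← sq_abs (Qerr P K X).1]
    gcongr
  have filter_share : ε ^ 2 / (2 * (B ^ 2 + 1)) * ‖r2err P K X‖ ^ 2 < ε ^ 2 / 2 := by
    calc _ ≤ ε ^ 2 / (2 * (B ^ 2 + 1)) * B ^ 2 := by gcongr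
      _ < ε ^ 2 / (2 * (B ^ 2 + 1)) * (B ^ 2 + 1) := by
          gcongr
          exact lt_add_one _
      _ = ε ^ 2 / 2 := by field_simp
  rw [attLyapunov]
  linarith

lemma IsSolution.bounded_and_tendsto_zero {P : Vehicle} {K : Gains} {t₀ : ℝ} {T : EReal}
    {x : ℝ → State} {a θ c₁ vb Λ : ℝ} {L' : ℝ → ℝ} (hx : IsSolution P K (timeInterval t₀ T) x)
    (hK : ThrustMargin P K) (hQ : ∀ t ∈ timeInterval t₀ T, IsUnitQuat (x t).Q)
    (hc₁ : 0 ≤ c₁) (hδ_diss : ∀ v, inner ℝ (P.δ v) v ≤ 0) (hδ : ∀ v, ‖P.δ v‖ ≤ c₁ * ‖v‖ ^ 2)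
    (ha : 0 ≤ a) (hθ : 0 ≤ θ) (hθ₀ : attLyapunov a P K (x t₀) < 1 - θ)
    (hvb : √(2 * (energy P K.kp (x t₀) + 1)) ≤ vb) (hΛ₀ : 0 < Λ)
    (hΛ : 4 * ((P.g + K.kp + K.kv) ^ 2 / (K.kv / √(1 + vb ^ 2))) ≤ Λ)
    (hL : ∀ t ∈ timeInterval t₀ T,
      HasDerivWithinAt (fun s => attLyapunov a P K (x s)) (L' t) (timeInterval t₀ T) t)
    (hL' : ∀ t ∈ timeInterval t₀ T, ‖(x t).v‖ ≤ vb → θ ≤ (Qerr P K (x t)).1 ^ 2 →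
      L' t ≤ -(Λ * attLyapunov a P K (x t))) :
    (∃ C : ℝ, ∀ t ∈ timeInterval t₀ T, ‖eP P (x t)‖ ≤ C ∧ ‖(x t).v‖ ≤ C) ∧
      (T = ⊤ → Filter.Tendsto (fun t => eP P (x t)) Filter.atTop (nhds 0) ∧
        Filter.Tendsto (fun t => (x t).v) Filter.atTop (nhds 0)) := by
  have kp_pos := hK.kp_pos
  have kv_pos := hK.kv_pos
  set eb := (energy P K.kp (x t₀) + 1) / K.kp + 1 with eb_def
  have bounds := hx.energy_le_of_attLyapunovRate_le hK hQ hδ_diss ha (by positivity) hΛ hvb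
    (div_mul_cancel₀ K.kv (by positivity)).le hθ hθ₀ hL hL'
  have v_le : ∀ t ∈ timeInterval t₀ T, ‖(x t).v‖ ≤ vb := fun t ht => (bounds t ht).2.1
  have e_le : ∀ t ∈ timeInterval t₀ T, ‖eP P (x t)‖ ≤ eb := fun t ht =>
    (norm_eP_le_energy_div kp_pos P (x t)).trans (by
      rw [eb_def]
      gcongr
      exact (bounds t ht).1)
  refine ⟨⟨max eb vb, fun t ht =>
    ⟨(e_le t ht).trans (le_max_left _ _), (v_le t ht).trans (le_max_right _ _)⟩⟩, ?_⟩
  rintro rfl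
  rw [timeInterval_top] at *
  have drag_le : ∀ t ∈ Set.Ici t₀, ‖P.δ (x t).v‖ ≤ c₁ * vb * ‖(x t).v‖ := by
    intro t ht
    calc ‖P.δ (x t).v‖ ≤ c₁ * ‖(x t).v‖ * ‖(x t).v‖ := (hδ _).trans_eq (by ring)
      _ ≤ c₁ * vb * ‖(x t).v‖ := by
          gcongr
          exact v_le t ht
  exact hx.tendsto_zero hK hQ hδ_diss drag_le
    (by positivity) (fun t ht => div_sqrt_mul_sqrt_le kv_pos.le (norm_nonneg _) (v_le t ht))
    (by positivity) (fun t ht => div_sqrt_mul_sqrt_le kp_pos.le (norm_nonneg _) (e_le t ht))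
    ha hΛ₀ hL fun t ht => (bounds t ht).2.2

theorem exists_gains_bounded_and_tendsto_zero {P : Vehicle} {kp kv c₁ c₂ c₃ : ℝ} (hkp : 0 < kp)
    (hkv : 0 < kv) (hg : kp + kv < P.g) (hc₁ : 0 ≤ c₁) (hc₃ : 0 ≤ c₃)
    (hδ_diss : ∀ v, inner ℝ (P.δ v) v ≤ 0) (hδ : ∀ v, ‖P.δ v‖ ≤ c₁ * ‖v‖ ^ 2)
    {cw : ℝ → ℝ → ℝ} (hcw : 0 < cw 1 1) (t₀ E₀ B : ℝ) {ε : ℝ} (hε : 0 < ε) :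
    ∃ γbar > 0, ∀ γ₁ > γbar, ∀ γ₂ > γbar, ∃ κ > 0, ∀ k₁ > κ, ∀ (T : EReal) (x : ℝ → State),
      IsSolution P ⟨kp, kv, γ₁, γ₂, k₁⟩ (timeInterval t₀ T) x →
      NonCollinear cw P ⟨kp, kv, γ₁, γ₂, k₁⟩ (timeInterval t₀ T) x →
      DisturbanceRate c₂ c₃ P (timeInterval t₀ T) x →
      IsUnitQuat (x t₀).Q → energy P kp (x t₀) ≤ E₀ →
      ε ≤ |(Qerr P ⟨kp, kv, γ₁, γ₂, k₁⟩ (x t₀)).1| →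
      ‖r2err P ⟨kp, kv, γ₁, γ₂, k₁⟩ (x t₀)‖ ≤ B →
      (∃ C : ℝ, ∀ t ∈ timeInterval t₀ T, ‖eP P (x t)‖ ≤ C ∧ ‖(x t).v‖ ≤ C) ∧
        (T = ⊤ → Filter.Tendsto (fun t => eP P (x t)) Filter.atTop (nhds 0) ∧
          Filter.Tendsto (fun t => (x t).v) Filter.atTop (nhds 0)) := by
  set vb := √(2 * (E₀ + 1))
  set Λ := 4 * ((P.g + kp + kv) ^ 2 / (kv / √(1 + vb ^ 2))) + 1
  have Λ_pos : 0 < Λ := by positivity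
  obtain ⟨γbar, γbar_pos, exists_filterGain⟩ := exists_gains_attLyapunovRate_le (c₂ := c₂)
    hkp hkv hg hc₁ hc₃ hδ hcw vb (θ := ε ^ 2 / 2) (by positivity) Λ_pos
  refine ⟨γbar, γbar_pos, fun γ₁ hγ₁ γ₂ hγ₂ => ?_⟩
  obtain ⟨κ, κ_pos, rate⟩ := exists_filterGain γ₁ hγ₁ γ₂ hγ₂ (ε ^ 2 / (2 * (B ^ 2 + 1)))
    (by positivity)
  refine ⟨κ, κ_pos, fun k₁ hk₁ T x hx hN hdist hQ₀ hE hη hB => ?_⟩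
  have hQ := hx.isUnitQuat hQ₀
  choose! L' hL hL' using rate k₁ hk₁ _ x hx hQ hN hdist
  exact hx.bounded_and_tendsto_zero ⟨hkp, hkv, hg⟩ hQ hc₁ hδ_diss hδ (by positivity)
    (by positivity) (attLyapunov_lt_of_filterErr_le hε hη hB) (Real.sqrt_le_sqrt (by gcongr))
    Λ_pos (le_add_of_nonneg_right zero_le_one) hL hL'

end

end VTOL

theorem mainTheorem1
    (g kp kv : ℝ) (hkp : 0 < kp) (hkv : 0 < kv) (hg : kp + kv < g)
    (r₁ pr : VTOL.E3)
    -- the aerodynamic disturbance: dissipative, and quadratically bounded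
    (δ : VTOL.E3 → VTOL.E3) (c₁ c₂ c₃ : ℝ) (hc₁ : 0 < c₁) (hc₂ : 0 < c₂) (hc₃ : 0 < c₃)
    (hδ_diss : ∀ v, inner ℝ (δ v) v ≤ 0)
    (hδ_bound : ∀ v, ‖δ v‖ ≤ c₁ * ‖v‖ ^ 2)
    -- the lower bound of the smallest eigenvalue of `W`
    (cw : ℝ → ℝ → ℝ) (hcw : ∀ a b, 0 < a → 0 < b → 0 < cw a b)
    (t₀ : ℝ) :
    -- bounds of the thrust, for all positive gains and all solutions
    (∀ γ₁ γ₂ k₁ : ℝ, 0 < γ₁ → 0 < γ₂ → 0 < k₁ →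
      ∀ (T : EReal) (x : ℝ → VTOL.State),
        VTOL.IsSolution ⟨g, r₁, δ, pr⟩ ⟨kp, kv, γ₁, γ₂, k₁⟩ (VTOL.timeInterval t₀ T) x →
        ∀ t ∈ VTOL.timeInterval t₀ T,
          0 < g - kp - kv ∧
          g - kp - kv ≤ VTOL.uT ⟨g, r₁, δ, pr⟩ ⟨kp, kv, γ₁, γ₂, k₁⟩ (x t) ∧
          VTOL.uT ⟨g, r₁, δ, pr⟩ ⟨kp, kv, γ₁, γ₂, k₁⟩ (x t) ≤ g + kp + kv) ∧
    -- boundedness and convergence, for all initial conditions with nonzero `η̃(t₀)`;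
    -- `B` bounds the initial filter error
    (∀ (p₀ v₀ : VTOL.E3) (Q₀ : ℝ × VTOL.E3) (B : ℝ), VTOL.IsUnitQuat Q₀ →
      (VTOL.qmul Q₀ (VTOL.qinv (VTOL.attD g (-(kp • VTOL.h (p₀ - pr)) - kv • VTOL.h v₀)))).1 ≠ 0 →
      ∃ γ₁bar > 0, ∃ γ₂bar > 0, ∀ γ₁ > γ₁bar, ∀ γ₂ > γ₂bar,
        ∃ κ₁ > 0, ∀ k₁ > κ₁,
          ∀ (T : EReal) (x : ℝ → VTOL.State),
            VTOL.IsSolution ⟨g, r₁, δ, pr⟩ ⟨kp, kv, γ₁, γ₂, k₁⟩ (VTOL.timeInterval t₀ T) x →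
            VTOL.NonCollinear cw ⟨g, r₁, δ, pr⟩ ⟨kp, kv, γ₁, γ₂, k₁⟩
              (VTOL.timeInterval t₀ T) x →
            VTOL.DisturbanceRate c₂ c₃ ⟨g, r₁, δ, pr⟩ (VTOL.timeInterval t₀ T) x →
            (x t₀).p = p₀ → (x t₀).v = v₀ → (x t₀).Q = Q₀ →
            ‖VTOL.r2err ⟨g, r₁, δ, pr⟩ ⟨kp, kv, γ₁, γ₂, k₁⟩ (x t₀)‖ ≤ B →
            (∃ C : ℝ, ∀ t ∈ VTOL.timeInterval t₀ T, ‖(x t).p - pr‖ ≤ C ∧ ‖(x t).v‖ ≤ C) ∧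
            (T = ⊤ →
              Filter.Tendsto (fun t => (x t).p - pr) Filter.atTop (nhds 0) ∧
              Filter.Tendsto (fun t => (x t).v) Filter.atTop (nhds 0))) := by
  refine ⟨fun γ₁ γ₂ k₁ _ _ _ T x _ t _ => ?_, fun p₀ v₀ Q₀ B hQ₀ hη => ?_⟩
  · have hK : VTOL.ThrustMargin ⟨g, r₁, δ, pr⟩ ⟨kp, kv, γ₁, γ₂, k₁⟩ := ⟨hkp, hkv, hg⟩
    exact ⟨by linarith, hK.le_uT (x t), hK.uT_le (x t)⟩
  · obtain ⟨γbar, γbar_pos, exists_filterGain⟩ :=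
      VTOL.exists_gains_bounded_and_tendsto_zero (P := ⟨g, r₁, δ, pr⟩) (c₂ := c₂) hkp hkv hg
        hc₁.le hc₃.le hδ_diss hδ_bound (hcw 1 1 one_pos one_pos) t₀
        (VTOL.energy ⟨g, r₁, δ, pr⟩ kp ⟨p₀, v₀, Q₀, 0⟩) B (abs_pos.2 hη)
    refine ⟨γbar, γbar_pos, γbar, γbar_pos, fun γ₁ hγ₁ γ₂ hγ₂ => ?_⟩
    obtain ⟨κ, κ_pos, conclusion⟩ := exists_filterGain γ₁ hγ₁ γ₂ hγ₂
    refine ⟨κ, κ_pos, fun k₁ hk₁ T x hx hN hdist hp hv hQ hB => ?_⟩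
    subst hp hv hQ
    exact conclusion k₁ hk₁ T x hx hN hdist hQ₀ le_rfl le_rfl hB
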